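/- **Setting.** Let $U^{\mathbb C}$ be the complexification of a compact Lie group $U$, with Lie algebra $\mathfrak u\oplus i\mathfrak u$ and Cartan involution $\Theta$ (an antiholomorphic involutive automorphism with fixed point group $U$), so that $U\times i\mathfrak u\to U^{\mathbb C}$, $(u,\alpha)\mapsto u\exp\alpha$, is a homeomorphism. Let $U^{\mathbb C}$ act holomorphically on a Kähler manifold $Z$ with $U$-invariant Kähler metric. Fix an $\mathrm{Ad}(U)$-invariant inner product $\langle\,,\rangle$ on $i\mathfrak u$ and a momentum map $\mu\colon Z\to i\mathfrak u$, i.e. a smooth $U$-equivariant map such that $\operatorname{grad}\mu^\alpha=\alpha_Z$ for all $\alpha\in i\mathfrak u$, where $\mu^\alpha=\langle\mu,\alpha\rangle$, the gradient is taken for the Riemannian metric of $Z$, and $\xi_Z(z)=\frac{d}{dt}\big|_{0}\exp(t\xi)\cdot z$. Let $G\subset U^{\mathbb C}$ be a closed subgroup with $G=K\exp\mathfrak p$, where $K=U\cap G$ and $\mathfrak p\subset i\mathfrak u$ is an $\mathrm{Ad}(K)$-stable linear subspace. Let $X\subset Z$ be a compact $G$-invariant subset, $\mu_{\mathfrak p}\colon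 X\to\mathfrak p$ the orthogonal projection of $\mu|_X$ to $\mathfrak p$, $\mu_{\mathfrak p}^\beta=\langle\mu_{\mathfrak p},\beta\rangle$ for $\beta\in\mathfrak p$, and $E$ the convex envelope of $\mu_{\mathfrak p}(X)$. Write $\xi_X(x)=\xi_Z(x)$ for $x\in X$ and $\xi$ in the Lie algebra of $G$. For $\beta\in\mathfrak p$ let $X^\beta=\{x\in X:\beta_X(x)=0\}$ and $X^\beta_{\max}=\{x\in X:\mu^\beta_{\mathfrak p}(x)=\max\mu_{\mathfrak p}^\beta(X)\}$. Let $G^\beta=\{g\in G:\exp(t\beta)g\exp(-t\beta)=g\ \forall t\in\mathbb R\}$, let $\mathfrak p^\beta$ be the intersection of $\mathfrak p$ with the Lie algebra of $G^\beta$, and for $\alpha\in\mathfrak p$ let $K^\alpha=\{k\in K:\mathrm{Ad}(k)\alpha=\alpha\}$. Let $\mathfrak r^{\beta_\pm}$ be the Lie algebra of $R^{\beta_\pm}=\{g\in G:\lim_{t\to\mp\infty}\exp(t\beta)g\exp(-t\beta)=e\}$. For $\sigma\in E$ let $C_\sigma$ be the set of $\beta\in\mathfrak p$ with $\{\alpha\in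 E:\langle\beta,\alpha\rangle\ge\langle\beta,\sigma\rangle\}=\{\sigma\}$, and $C_\sigma^{K^\sigma}$ the set of $\beta\in C_\sigma$ fixed by $\mathrm{Ad}(K^\sigma)$. **Proposition.** Let $\sigma$ be an extreme point of $E$. 1. For every $\beta\in C_\sigma$, $\mu_{\mathfrak p}^{-1}(\sigma)=X^\beta_{\max}$. 2. For every $\beta\in\mathfrak p$ (in particular for $\beta\in C_\sigma$), $X^\beta_{\max}$ is contained in $X^\beta$, is open and closed in $X^\beta$, and is $G^\beta$-stable. 3. For every $\beta\in C_\sigma$, every $G^\beta$-orbit in $X^\beta_{\max}$ is compact, and $\alpha_X(x)=0$ for all $x\in X^\beta_{\max}$ and $\alpha\in\mathfrak p^\beta$. 4. For every $\beta\in C_\sigma$, $x\in X^\beta_{\max}$ and $\xi\in\mathfrak r^{\beta_+}$, $\xi_X(x)=0$. 5. For every $\beta\in C_\sigma^{K^\sigma}$, $K^\sigma=K^\beta$. 6. For every $\beta\in C_\sigma^{K^\sigma}$, $x\in X^\beta_{\max}$ and $0\ne\xi\in\mathfrak r^{\beta_-}$, $\xi_X(x)\ne0$. -/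

import Mathlib

open scoped Manifold ContDiff Topology

noncomputable section

namespace GradientMap

/-! ### Complex manifolds as real manifolds -/

/-- The real analytic manifold underlying a complex manifold (same atlas). -/
instance isManifold_real {F : Type*} [NormedAddCommGroup F] [NormedSpace ℂ F]
    {Z : Type*} [TopologicalSpace Z] [ChartedSpace F Z] [IsManifold 𝓘(ℂ, F) ω Z] :
    IsManifold 𝓘(ℝ, F) ω Z := by
  refine isManifold_of_contDiffOn 𝓘(ℝ, F) ω Z fun e e' he he' => ?_
  have h := (HasGroupoid.compatible (G := contDiffGroupoid ω 𝓘(ℂ, F)) he he')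
  rw [contDiffGroupoid, mem_groupoid_of_pregroupoid] at h
  have h1 := h.1
  simp only [contDiffPregroupoid, modelWithCornersSelf_coe, modelWithCornersSelf_coe_symm,
    Function.comp_id, Function.id_comp, Set.preimage_id, Set.range_id, Set.inter_univ] at h1 ⊢
  exact h1.restrict_scalars ℝ

/-- The real differential of `f` at `x`, on tangent vectors; the tangent spaces of manifolds modelled
on `E` and `F` are by definition the vector spaces `E` and `F`. -/
def diffReal {E : Type*} [NormedAddCommGroup E] [NormedSpace ℝ E]
    {F : Type*} [NormedAddCommGroup F] [NormedSpace ℝ F]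
    {M : Type*} [TopologicalSpace M] [ChartedSpace E M]
    {N : Type*} [TopologicalSpace N] [ChartedSpace F N] (f : M → N) (x : M) : E →L[ℝ] F :=
  mfderiv 𝓘(ℝ, E) 𝓘(ℝ, F) f x

/-- The complex differential of `f` at `x`. -/
def diffComplex {E : Type*} [NormedAddCommGroup E] [NormedSpace ℂ E]
    {F : Type*} [NormedAddCommGroup F] [NormedSpace ℂ F]
    {M : Type*} [TopologicalSpace M] [ChartedSpace E M]
    {N : Type*} [TopologicalSpace N] [ChartedSpace F N] (f : M → N) (x : M) : E →L[ℂ] F :=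
  mfderiv 𝓘(ℂ, E) 𝓘(ℂ, F) f x

/-! ### Lie theory of a complex Lie group

`S` is a complex Lie group modelled on `E`.  Its Lie algebra is the tangent space at `1`, which is
by definition the model space `E`; hence elements of the Lie algebra are written as `ξ : E`. -/

section LieTheory

variable {E : Type*} [NormedAddCommGroup E] [NormedSpace ℂ E]
  {S : Type*} [Group S] [TopologicalSpace S] [ChartedSpace E S]

/-- `γ` is a one-parameter subgroup of `S` with initial velocity `ξ`. -/
structure IsOneParameterSubgroup (γ : ℝ → S) (ξ : E) : Prop where
  map_add : ∀ s t : ℝ, γ (s + t) = γ s * γ t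
  velocity : HasMFDerivAt 𝓘(ℝ, ℝ) 𝓘(ℝ, E) γ 0
    (ContinuousLinearMap.toSpanSingleton ℝ (ξ : TangentSpace 𝓘(ℝ, E) (γ 0)))

open Classical in
/-- The exponential map: the value at time `1` of the one-parameter subgroup with velocity `ξ`
(which exists and is unique in a Lie group). -/
def lieExp (S : Type*) [Group S] [TopologicalSpace S] [ChartedSpace E S] (ξ : E) : S :=
  if h : ∃ γ : ℝ → S, IsOneParameterSubgroup γ ξ then h.choose 1 else 1

/-- The adjoint action: the differential at `1` of conjugation by `g`. -/
def Ad (g : S) : E →L[ℂ] E :=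
  diffComplex (fun h : S => g * h * g⁻¹) 1

/-- The Lie algebra of a closed subgroup of `S` with underlying set `H`. -/
def lieAlgebraOf (H : Set S) : Set E := {ξ | ∀ t : ℝ, lieExp S (t • ξ) ∈ H}

/-- The subgroup of fixed points of an automorphism. -/
def fixedSubgroup (Θ : S ≃* S) : Subgroup S where
  carrier := {g | Θ g = g}
  mul_mem' := by
    intro a b ha hb
    simp only [Set.mem_ofPred_eq] at ha hb ⊢
    rw [map_mul, ha, hb]
  one_mem' := map_one Θ
  inv_mem' := by
    intro a ha
    simp only [Set.mem_ofPred_eq] at ha ⊢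
    rw [map_inv, ha]

/-- The `-1`-eigenspace of the differential of `Θ`.  When `Θ` is a Cartan involution with fixed
point group `U`, the `+1`-eigenspace is the Lie algebra `𝔲` of `U` and this is `i𝔲`. -/
def iu (Θ : S ≃* S) : Submodule ℝ E where
  carrier := {ξ | (diffReal Θ (1 : S) : E →L[ℝ] E) ξ = -ξ}
  add_mem' := by
    intro a b ha hb
    simp only [Set.mem_ofPred_eq] at ha hb ⊢
    rw [map_add, ha, hb, neg_add]
  zero_mem' := by simp
  smul_mem' := by
    intro c a ha
    simp only [Set.mem_ofPred_eq] at ha ⊢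
    rw [map_smul, ha, smul_neg]

/-- `Θ` is a Cartan involution of the complex Lie group `S`, so that `S = U^ℂ` is the
complexification of the compact group `U` of fixed points of `Θ`: an antiholomorphic involutive
automorphism with compact fixed point group `U` such that `U × i𝔲 → S`, `(u, α) ↦ u exp α`, is a
homeomorphism. -/
structure IsCartanInvolution (E : Type*) [NormedAddCommGroup E] [NormedSpace ℂ E]
    {S : Type*} [Group S] [TopologicalSpace S] [ChartedSpace E S] (Θ : S ≃* S) : Prop where
  smooth : ContMDiff 𝓘(ℝ, E) 𝓘(ℝ, E) ∞ (Θ : S → S)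
  antiholomorphic : ∀ (g : S) (v : E),
    (diffReal Θ g : E →L[ℝ] E) (Complex.I • v) = -(Complex.I • (diffReal Θ g : E →L[ℝ] E) v)
  involutive : Function.Involutive (Θ : S → S)
  compact : IsCompact (fixedSubgroup Θ : Set S)
  cartan : IsHomeomorph (fun q : fixedSubgroup Θ × (iu Θ : Submodule ℝ E) => (q.1 : S) * lieExp S (q.2 : E))

/-- `B` restricts to an `Ad(U)`-invariant inner product on `i𝔲`. (Only this restriction is ever
used.) -/
structure IsInvariantInnerProduct (Θ : S ≃* S) (B : LinearMap.BilinForm ℝ E) : Prop where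
  symm : ∀ α ∈ iu Θ, ∀ β ∈ iu Θ, B α β = B β α
  pos : ∀ α ∈ iu Θ, α ≠ 0 → 0 < B α α
  invariant : ∀ u ∈ fixedSubgroup Θ, ∀ α ∈ iu Θ, ∀ β ∈ iu Θ, B (Ad u α) (Ad u β) = B α β

/-- The closed subgroup `G` is compatible with the Cartan decomposition of `S = U exp(i𝔲)`:
`G = K exp 𝔭` with `K = U ∩ G` and `𝔭 ⊆ i𝔲` an `Ad(K)`-stable linear subspace.  By the
Cartan decomposition of `S`, the subspace `𝔭` is then the intersection of `i𝔲` with the Lie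
algebra of `G`, and `K × 𝔭 → G` is a homeomorphism. -/
structure IsCompatible (Θ : S ≃* S) (G : Subgroup S) (p : Submodule ℝ E) : Prop where
  closed : IsClosed (G : Set S)
  le_iu : p ≤ iu Θ
  ad_stable : ∀ k ∈ fixedSubgroup Θ ⊓ G, ∀ α ∈ p, Ad k α ∈ p
  mem_iff : ∀ g : S, g ∈ G ↔ ∃ k ∈ fixedSubgroup Θ ⊓ G, ∃ α ∈ p, g = k * lieExp S α

/-- The centralizer `K^α` of `α` in `K = U ∩ G`. -/
def stabK (Θ : S ≃* S) (G : Subgroup S) (α : E) : Set S :=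
  {k | k ∈ fixedSubgroup Θ ⊓ G ∧ Ad k α = α}

/-- The centralizer `G^β` of `β` in `G`. -/
def centralizerIn (G : Subgroup S) (β : E) : Subgroup S :=
  G ⊓ Subgroup.centralizer {h | ∃ t : ℝ, h = lieExp S (t • β)}

/-- `R^{β+}`: the `g ∈ G` with `exp(tβ) g exp(-tβ) → e` as `t → -∞`. -/
def Rplus (G : Subgroup S) (β : E) : Set S :=
  {g | g ∈ G ∧ Filter.Tendsto (fun t : ℝ => lieExp S (t • β) * g * lieExp S (-(t • β)))
    Filter.atBot (𝓝 1)}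

/-- `R^{β-}`: the `g ∈ G` with `exp(tβ) g exp(-tβ) → e` as `t → +∞`. -/
def Rminus (G : Subgroup S) (β : E) : Set S :=
  {g | g ∈ G ∧ Filter.Tendsto (fun t : ℝ => lieExp S (t • β) * g * lieExp S (-(t • β)))
    Filter.atTop (𝓝 1)}

/-- `𝔭^β`: the part of `𝔭` in the Lie algebra of `G^β`. -/
def pCentralizer (G : Subgroup S) (p : Submodule ℝ E) (β : E) : Set E :=
  {α | α ∈ p ∧ α ∈ lieAlgebraOf (centralizerIn G β : Set S)}

end LieTheory

/-! ### Orthogonal projection with respect to a bilinear form -/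

section Projection

variable {E : Type*} [AddCommGroup E] [Module ℝ E]

open Classical in
/-- The `B`-orthogonal projection of `v` to the subspace `p`: the element `w` of `p` with
`B w α = B v α` for all `α ∈ p` (it exists and is unique if `B` is an inner product on `p` and `p`
is finite dimensional). -/
def orthProj (B : LinearMap.BilinForm ℝ E) (p : Submodule ℝ E) (v : E) : E :=
  if h : ∃ w ∈ p, ∀ α ∈ p, B w α = B v α then h.choose else 0

theorem exists_orthProj (B : LinearMap.BilinForm ℝ E) (p : Submodule ℝ E)
    [FiniteDimensional ℝ p] (hB : ∀ α ∈ p, α ≠ 0 → 0 < B α α) (v : E) :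
    ∃ w ∈ p, ∀ α ∈ p, B w α = B v α := by
  have hinj : Function.Injective (B.restrict p) := by
    rw [injective_iff_map_eq_zero]
    intro a ha
    by_contra hne
    have h1 := hB a a.2 (by simpa using hne)
    have h2 : B.restrict p a a = 0 := by rw [ha]; rfl
    exact absurd h2 (ne_of_gt h1)
  have hsurj : Function.Surjective (B.restrict p) :=
    (LinearMap.injective_iff_surjective_of_finrank_eq_finrank
      (Subspace.dual_finrank_eq (K := ℝ) (V := p)).symm).1 hinj
  obtain ⟨w, hw⟩ := hsurj ((B v).comp p.subtype)
  exact ⟨w, w.2, fun α hα => LinearMap.congr_fun hw ⟨α, hα⟩⟩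

theorem orthProj_spec (B : LinearMap.BilinForm ℝ E) (p : Submodule ℝ E)
    [FiniteDimensional ℝ p] (hB : ∀ α ∈ p, α ≠ 0 → 0 < B α α) (v : E) :
    orthProj B p v ∈ p ∧ ∀ α ∈ p, B (orthProj B p v) α = B v α := by
  have h := exists_orthProj B p hB v
  rw [orthProj, dif_pos h]
  exact h.choose_spec

end Projection

/-! ### Kähler manifolds -/

section Kahler

variable (F : Type*) [NormedAddCommGroup F] [NormedSpace ℂ F]
  (Z : Type*) [TopologicalSpace Z] [ChartedSpace F Z] [IsManifold 𝓘(ℂ, F) ω Z]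

/-- A smooth Riemannian metric on the real manifold underlying `Z`. -/
abbrev RiemMetric := Bundle.ContMDiffRiemannianMetric 𝓘(ℝ, F) ∞ F
  (fun z : Z => TangentSpace 𝓘(ℝ, F) z)

variable {F Z}

/-- The scalar product `(v, w)_z` of tangent vectors at `z`. -/
def RiemMetric.ip (h : RiemMetric F Z) (z : Z) (v w : F) : ℝ :=
  h.inner z (v : TangentSpace 𝓘(ℝ, F) z) (w : TangentSpace 𝓘(ℝ, F) z)

/-- The form `(v, w) ↦ (Jv, w)` in the coordinates given by the chart `e`. -/
def RiemMetric.formInChart (h : RiemMetric F Z) (e : OpenPartialHomeomorph Z F) (y v w : F) : ℝ :=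
  h.ip (e.symm y)
    (Complex.I • (diffReal e.symm y : F →L[ℝ] F) v)
    ((diffReal e.symm y : F →L[ℝ] F) w)

/-- `h` is a Kähler metric: it is Hermitian and the form `ω(v, w) = (Jv, w)` is closed. -/
structure RiemMetric.IsKahler (h : RiemMetric F Z) : Prop where
  hermitian : ∀ (z : Z) (v w : F), h.ip z (Complex.I • v) (Complex.I • w) = h.ip z v w
  closed : ∀ e ∈ atlas F Z, ∀ y ∈ e.target, ∀ v₁ v₂ v₃ : F,
    fderiv ℝ (fun y' => h.formInChart e y' v₂ v₃) y v₁
      + fderiv ℝ (fun y' => h.formInChart e y' v₃ v₁) y v₂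
      + fderiv ℝ (fun y' => h.formInChart e y' v₁ v₂) y v₃ = 0

end Kahler

/-! ### Hamiltonian actions and gradient maps -/

section Action

variable {E : Type*} [NormedAddCommGroup E] [NormedSpace ℂ E]
  {S : Type*} [Group S] [TopologicalSpace S] [ChartedSpace E S]
  {F : Type*} [NormedAddCommGroup F] [NormedSpace ℂ F]
  {Z : Type*} [TopologicalSpace Z] [ChartedSpace F Z] [MulAction S Z]

/-- The value `ξ_Z(z)` of the fundamental vector field of `ξ`: the image of `ξ` under the
differential at `1` of the orbit map `g ↦ g • z`. -/
def fundVec (S : Type*) [Group S] [TopologicalSpace S] [ChartedSpace E S] [MulAction S Z]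
    (F : Type*) [NormedAddCommGroup F] [NormedSpace ℂ F] [ChartedSpace F Z] (ξ : E) (z : Z) : F :=
  diffComplex (fun g : S => g • z) 1 ξ

/-- The metric is invariant under the group `U`. -/
def RiemMetric.IsInvariant [IsManifold 𝓘(ℂ, F) ω Z] (h : RiemMetric F Z) (U : Subgroup S) : Prop :=
  ∀ u ∈ U, ∀ (z : Z) (v w : F),
    h.ip (u • z) ((diffReal (fun z' : Z => u • z') z : F →L[ℝ] F) v)
      ((diffReal (fun z' : Z => u • z') z : F →L[ℝ] F) w) = h.ip z v w

/-- `μ : Z → i𝔲` is a momentum map: smooth, `U`-equivariant, and `grad μ^α = α_Z` for every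
`α ∈ i𝔲`, where `μ^α(z) = ⟨μ(z), α⟩`. -/
structure IsMomentumMap [IsManifold 𝓘(ℂ, F) ω Z] (Θ : S ≃* S) (B : LinearMap.BilinForm ℝ E)
    (h : RiemMetric F Z) (μ : Z → E) : Prop where
  mem_iu : ∀ z, μ z ∈ iu Θ
  smooth : ContMDiff 𝓘(ℝ, F) 𝓘(ℝ, E) ∞ μ
  equivariant : ∀ u ∈ fixedSubgroup Θ, ∀ z, μ (u • z) = Ad u (μ z)
  gradient : ∀ α ∈ iu Θ, ∀ (z : Z) (v : F),
    (diffReal (fun z' => B (μ z') α) z : F →L[ℝ] ℝ) v = h.ip z (fundVec S F α z) v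

/-- The restricted momentum map (gradient map) `μ_𝔭`: the orthogonal projection of `μ` to `𝔭`. -/
def restrictedMomentum (B : LinearMap.BilinForm ℝ E) (p : Submodule ℝ E) (μ : Z → E) (z : Z) : E :=
  orthProj B p (μ z)

/-- The convex envelope of `μ_𝔭(X)`. -/
def momentumHull (B : LinearMap.BilinForm ℝ E) (p : Submodule ℝ E) (μ : Z → E) (X : Set Z) :
    Set E :=
  convexHull ℝ (restrictedMomentum B p μ '' X)

/-- `C_σ`: the set of `β ∈ 𝔭` which expose `σ`, that is,
`{α ∈ hull | ⟨β, α⟩ ≥ ⟨β, σ⟩} = {σ}`. -/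
def exposingCone (B : LinearMap.BilinForm ℝ E) (p : Submodule ℝ E) (hull : Set E) (σ : E) :
    Set E :=
  {β | β ∈ p ∧ hull ∩ {α | α ∈ p ∧ B β σ ≤ B β α} = {σ}}

/-- `C_σ^{K^σ}`: the `K^σ`-fixed points of `C_σ`. -/
def exposingConeFixed (Θ : S ≃* S) (G : Subgroup S) (B : LinearMap.BilinForm ℝ E)
    (p : Submodule ℝ E) (hull : Set E) (σ : E) : Set E :=
  {β | β ∈ exposingCone B p hull σ ∧ ∀ k ∈ stabK Θ G σ, Ad k β = β}

/-- `X^β`: the zeros in `X` of the vector field of `β`. -/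
def zeroSet (S : Type*) [Group S] [TopologicalSpace S] [ChartedSpace E S] [MulAction S Z]
    (F : Type*) [NormedAddCommGroup F] [NormedSpace ℂ F] [ChartedSpace F Z] (X : Set Z) (β : E) : Set Z :=
  {x | x ∈ X ∧ fundVec S F β x = 0}

/-- `X^β_max`: the points of `X` where `μ_𝔭^β = ⟨μ_𝔭, β⟩` takes its maximum over `X`. -/
def maxSet (B : LinearMap.BilinForm ℝ E) (p : Submodule ℝ E) (μ : Z → E) (X : Set Z) (β : E) :
    Set Z :=
  {x | x ∈ X ∧ ∀ y ∈ X, B (restrictedMomentum B p μ y) β ≤ B (restrictedMomentum B p μ x) β}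

end Action

end GradientMap

end

open scoped Manifold ContDiff Topology

set_option linter.unusedSectionVars false

noncomputable section

namespace GradientMap

/-! ### Holomorphic maps viewed as real analytic maps -/

section RestrictScalars
variable {E : Type*} [NormedAddCommGroup E] [NormedSpace ℂ E]
  {F : Type*} [NormedAddCommGroup F] [NormedSpace ℂ F]
  {F' : Type*} [NormedAddCommGroup F'] [NormedSpace ℂ F']
  {M : Type*} [TopologicalSpace M] [ChartedSpace E M]
  {N : Type*} [TopologicalSpace N] [ChartedSpace F N]
  {N' : Type*} [TopologicalSpace N'] [ChartedSpace F' N']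

/-! The engine is one computation: along `exp(tξ)z` the function `μ^α` has derivative `(α_Z, ξ_Z)`.
For `ξ = α` this is `|α_Z|²`, so `μ^α` is nondecreasing along the flow of `α`, and it can take equal
values at two times only at a zero of `α_Z`. Maximality on the invariant set `X` therefore forces
`β_X = 0` on `X^β_max`. An extreme point of the hull of `μ_𝔭(X)` lies in `μ_𝔭(X)`, so the fibre over
an exposed `σ` is exactly the set where `μ^β` is maximal.

Openness of `X^β_max` in `X^β` says that `μ^β` is locally constant on the zeros of `β_Z`. These
zeros are the fixed points of a compact subgroup of `U` containing all `exp(tiβ)`, and `μ^β` is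
critical there. Averaging over that subgroup linearizes its action near a fixed point; in these
coordinates the fixed points form a linear subspace, and a function critical along it is constant on
segments.

The centralizer `G^β` has its own decomposition `K^β exp(𝔭^β)` (`Ad_factors_eq_self`), which gives
stability of `X^β_max`. When `X^β_max` is the fibre over `σ`, the map `μ_𝔭` is constant on it; hence
`𝔭^β` acts trivially there, and orbits of `G^β` are orbits of the compact group `K^β`.

For `g ∈ R^{β+}` and `x ∈ X^β_max`, the curve `exp(tβ)gx` tends to `x` as `t → -∞` while `μ^β`
increases along it. Thus `gx` is again maximal, hence fixed by `exp(tβ)`, and so `gx = x`.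

For `g = k exp α ∈ R^{β-}` fixing `x`, the element `Θ(g)` lies in `R^{β+}` and also fixes `x`. Hence
`exp(2α) = Θ(g)⁻¹g` fixes `x`, so `α` and then `k` fix `x`, and `k ∈ K^σ` fixes `β`. The conjugates
of `g` by `exp(tβ)` then converge at both ends of the line, and Liouville's theorem applied to
`exp(w ad β) Ad(g) exp(-w ad β)` (`Ad_eq_of_tendsto_conj`) shows that this function is constant. So
`g` commutes with `exp(tβ)`, and being in `R^{β-}` it is `1`. -/

theorem contMDiff_real_of_complex [IsManifold 𝓘(ℂ, E) ω M] [IsManifold 𝓘(ℂ, F) ω N]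
    {f : M → N} (hf : ContMDiff 𝓘(ℂ, E) 𝓘(ℂ, F) ω f) : ContMDiff 𝓘(ℝ, E) 𝓘(ℝ, F) ω f := by
  rw [contMDiff_iff] at hf ⊢
  exact ⟨hf.1, fun x y => (hf.2 x y).restrict_scalars ℝ⟩

theorem contMDiff_prod_real_of_complex [IsManifold 𝓘(ℂ, E) ω M] [IsManifold 𝓘(ℂ, F) ω N]
    [IsManifold 𝓘(ℂ, F') ω N'] {f : M × N → N'}
    (hf : ContMDiff (𝓘(ℂ, E).prod 𝓘(ℂ, F)) 𝓘(ℂ, F') ω f) :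
    ContMDiff (𝓘(ℝ, E).prod 𝓘(ℝ, F)) 𝓘(ℝ, F') ω f := by
  rw [contMDiff_iff] at hf ⊢
  exact ⟨hf.1, fun x y => (hf.2 x y).restrict_scalars ℝ⟩

theorem hasMFDerivAt_real_of_complex {f : M → N} {x : M} {f' : E →L[ℂ] F}
    (hf : HasMFDerivAt 𝓘(ℂ, E) 𝓘(ℂ, F) f x f') :
    HasMFDerivAt 𝓘(ℝ, E) 𝓘(ℝ, F) f x (f'.restrictScalars ℝ) :=
  ⟨hf.1, hf.2.restrictScalars ℝ⟩

instance lieGroup_real {S : Type*} [Group S] [TopologicalSpace S] [ChartedSpace E S]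
    [LieGroup 𝓘(ℂ, E) ω S] : LieGroup 𝓘(ℝ, E) ω S where
  contMDiff_mul := contMDiff_prod_real_of_complex (contMDiff_mul 𝓘(ℂ, E) ω)
  contMDiff_inv := contMDiff_real_of_complex (contMDiff_inv 𝓘(ℂ, E) ω)

end RestrictScalars

/-! ### Velocities of curves in manifolds -/

section Velocity
variable {E : Type*} [NormedAddCommGroup E] [NormedSpace ℝ E]
  {F : Type*} [NormedAddCommGroup F] [NormedSpace ℝ F]
  {M : Type*} [TopologicalSpace M] [ChartedSpace E M]
  {N : Type*} [TopologicalSpace N] [ChartedSpace F N]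

/-- The curve `γ` has velocity `v` at time `t`. -/
def HasVelocityAt (γ : ℝ → M) (v : E) (t : ℝ) : Prop :=
  HasMFDerivAt 𝓘(ℝ, ℝ) 𝓘(ℝ, E) γ t
    (ContinuousLinearMap.toSpanSingleton ℝ (v : TangentSpace 𝓘(ℝ, E) (γ t)))

theorem HasVelocityAt.unique {γ : ℝ → M} {v w : E} {t : ℝ} (hv : HasVelocityAt γ v t)
    (hw : HasVelocityAt γ w t) : v = w := by
  have h : (ContinuousLinearMap.toSpanSingleton ℝ v : ℝ →L[ℝ] E) =
      ContinuousLinearMap.toSpanSingleton ℝ w := hasMFDerivAt_unique hv hw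
  have := congrArg (fun L : ℝ →L[ℝ] E => L 1) h
  simpa using this

theorem HasVelocityAt.comp_hasMFDerivAt {γ : ℝ → M} {v : E} {t : ℝ} (hv : HasVelocityAt γ v t)
    {f : M → N} {L : E →L[ℝ] F} (hf : HasMFDerivAt 𝓘(ℝ, E) 𝓘(ℝ, F) f (γ t) L) :
    HasVelocityAt (fun s => f (γ s)) (L v) t := by
  have key : L ∘L (ContinuousLinearMap.toSpanSingleton ℝ v) =
      ContinuousLinearMap.toSpanSingleton ℝ (L v) := by ext; simp
  exact (HasMFDerivAt.comp t hf hv).congr_mfderiv key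

theorem HasVelocityAt.comp_mdifferentiableAt {γ : ℝ → M} {v : E} {t : ℝ}
    (hv : HasVelocityAt γ v t) {f : M → N} (hf : MDifferentiableAt 𝓘(ℝ, E) 𝓘(ℝ, F) f (γ t)) :
    HasVelocityAt (fun s => f (γ s)) ((diffReal f (γ t) : E →L[ℝ] F) v) t :=
  hv.comp_hasMFDerivAt hf.hasMFDerivAt

theorem HasVelocityAt.continuousAt {γ : ℝ → M} {v : E} {t : ℝ} (hv : HasVelocityAt γ v t) :
    ContinuousAt γ t := HasMFDerivAt.continuousAt hv

theorem hasVelocityAt_iff_hasDerivAt {γ : ℝ → E} {v : E} {t : ℝ} :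
    HasVelocityAt γ v t ↔ HasDerivAt γ v t :=
  hasMFDerivAt_iff_hasFDerivAt.trans
    (hasDerivAt_iff_hasFDerivAt (f := γ) (f' := v) (x := t)).symm

theorem HasVelocityAt.scomp {γ : ℝ → M} {v : E} {t : ℝ} {a : ℝ → ℝ} {c : ℝ}
    (hv : HasVelocityAt γ v (a t)) (ha : HasDerivAt a c t) :
    HasVelocityAt (fun s => γ (a s)) (c • v) t := by
  have key : (ContinuousLinearMap.toSpanSingleton ℝ v : ℝ →L[ℝ] E) ∘L
      (ContinuousLinearMap.toSpanSingleton ℝ c) =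
      ContinuousLinearMap.toSpanSingleton ℝ (c • v) := by ext; simp
  exact (HasMFDerivAt.comp t hv
    (hasMFDerivAt_iff_hasFDerivAt.2 ha.hasFDerivAt)).congr_mfderiv key

/-- Such a curve and a constant curve are both integral curves of the zero vector field, so
uniqueness applies. -/
theorem constant_of_hasVelocityAt_zero [T2Space M] [IsManifold 𝓘(ℝ, E) 1 M] {γ : ℝ → M}
    (h : ∀ t, HasVelocityAt γ (0 : E) t) (s t : ℝ) : γ s = γ t := by
  have hc : ∀ x : M, IsMIntegralCurve (I := 𝓘(ℝ, E)) (fun _ : ℝ => x) (fun _ => 0) := fun x =>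
    isMIntegralCurve_const rfl
  have key : (ContinuousLinearMap.toSpanSingleton ℝ (0 : E) : ℝ →L[ℝ] E) =
      (1 : ℝ →L[ℝ] ℝ).smulRight 0 := by ext; simp
  have hγ : IsMIntegralCurve (I := 𝓘(ℝ, E)) γ (fun _ => 0) := fun t =>
    HasMFDerivAt.congr_mfderiv (h t) key
  exact congrFun (isMIntegralCurve_Ioo_eq_of_contMDiff_boundaryless (t₀ := t)
    (Bundle.contMDiff_zeroSection ℝ (TangentSpace 𝓘(ℝ, E))) hγ (hc (γ t)) rfl) s

end Velocity

/-! ### One-parameter subgroups, the exponential map and the adjoint action -/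

section OneParameter
variable {E : Type*} [NormedAddCommGroup E] [NormedSpace ℂ E]
  {S : Type*} [Group S] [TopologicalSpace S] [ChartedSpace E S] [LieGroup 𝓘(ℂ, E) ω S]

instance lieGroup_real_three : LieGroup 𝓘(ℝ, E) (minSmoothness ℝ 3) S :=
  LieGroup.of_le (n := ω) le_top

theorem hasVelocityAt_iff_smulRight {M : Type*} [TopologicalSpace M] [ChartedSpace E M]
    {γ : ℝ → M} {v : E} {t : ℝ} :
    HasVelocityAt γ v t ↔ HasMFDerivAt 𝓘(ℝ, ℝ) 𝓘(ℝ, E) γ t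
      ((1 : ℝ →L[ℝ] ℝ).smulRight v : ℝ →L[ℝ] E) := by
  have key : (ContinuousLinearMap.toSpanSingleton ℝ v : ℝ →L[ℝ] E) =
      (1 : ℝ →L[ℝ] ℝ).smulRight v := by ext; simp
  exact ⟨fun h => HasMFDerivAt.congr_mfderiv h key, fun h => HasMFDerivAt.congr_mfderiv h key.symm⟩

theorem mdifferentiable_mul_left_real (g : S) :
    MDifferentiable 𝓘(ℝ, E) 𝓘(ℝ, E) (fun h : S => g * h) :=
  (contMDiff_mul_left (I := 𝓘(ℝ, E)) (n := ω)).mdifferentiable (by simp)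

variable (S) in
/-- The left invariant vector field on `S` with value `ξ` at `1`. -/
def leftField (ξ : E) (g : S) : E := (diffReal (fun h : S => g * h) 1 : E →L[ℝ] E) ξ

theorem contMDiff_leftField (ξ : E) : ContMDiff 𝓘(ℝ, E) 𝓘(ℝ, E).tangent 1
    (fun g : S => (⟨g, leftField (E := E) S ξ g⟩ : TangentBundle 𝓘(ℝ, E) S)) :=
  (contMDiff_mulInvariantVectorField (I := 𝓘(ℝ, E)) (G := S) ξ).of_le
    (by simp [minSmoothness_of_isRCLikeNormedField])

theorem leftField_mul (ξ : E) (g h : S) :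
    (diffReal (fun k : S => g * k) h : E →L[ℝ] E) (leftField S ξ h) = leftField S ξ (g * h) := by
  have h1 : HasMFDerivAt 𝓘(ℝ, E) 𝓘(ℝ, E) (fun k : S => h * k) 1
    (diffReal (fun k : S => h * k) 1 : E →L[ℝ] E) :=
    (mdifferentiable_mul_left_real h 1).hasMFDerivAt
  have h2 : HasMFDerivAt 𝓘(ℝ, E) 𝓘(ℝ, E) (fun k : S => g * k) (h * 1)
    (diffReal (fun k : S => g * k) h : E →L[ℝ] E) := by
    rw [mul_one]; exact (mdifferentiable_mul_left_real g h).hasMFDerivAt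
  have h3 := (HasMFDerivAt.comp 1 h2 h1).mfderiv
  have h4 : (fun k : S => g * k) ∘ (fun k : S => h * k) = fun k => g * h * k := by
    ext; simp [mul_assoc]
  rw [h4] at h3
  exact (congrArg (fun L : E →L[ℝ] E => L ξ) h3).symm

theorem isMIntegralCurve_leftField_iff {ξ : E} {γ : ℝ → S} :
    IsMIntegralCurve (I := 𝓘(ℝ, E)) γ (leftField S ξ) ↔
      ∀ t, HasVelocityAt γ (leftField S ξ (γ t)) t :=
  forall_congr' fun _ => hasVelocityAt_iff_smulRight.symm

theorem leftField_one (ξ : E) : leftField S ξ 1 = ξ := by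
  have h4 : (fun k : S => 1 * k) = id := by ext; simp
  have h5 : (diffReal (fun k : S => 1 * k) 1 : E →L[ℝ] E) = ContinuousLinearMap.id ℝ E := by
    rw [h4]; exact mfderiv_id
  rw [leftField, h5, ContinuousLinearMap.id_apply]

theorem IsOneParameterSubgroup.map_zero {γ : ℝ → S} {ξ : E} (hγ : IsOneParameterSubgroup γ ξ) :
    γ 0 = 1 := by
  have := hγ.map_add 0 0
  simpa using this

theorem IsOneParameterSubgroup.hasVelocityAt {γ : ℝ → S} {ξ : E}
    (hγ : IsOneParameterSubgroup γ ξ) (t : ℝ) : HasVelocityAt γ (leftField S ξ (γ t)) t := by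
  have h0 : HasVelocityAt γ ξ (t - t) := by rw [sub_self]; exact hγ.velocity
  have h1 := (h0.scomp (a := fun s => s - t) ((hasDerivAt_id t).sub_const t)).comp_mdifferentiableAt
    (mdifferentiable_mul_left_real (γ t) _)
  have h2 : (fun s => γ t * γ (s - t)) = γ := by
    ext s; rw [← hγ.map_add]; congr 1; ring
  rw [h2, sub_self, hγ.map_zero, one_smul] at h1
  exact h1

variable [T2Space S]

theorem IsOneParameterSubgroup.eq {γ γ' : ℝ → S} {ξ : E}
    (hγ : IsOneParameterSubgroup γ ξ) (hγ' : IsOneParameterSubgroup γ' ξ) : γ = γ' :=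
  isMIntegralCurve_Ioo_eq_of_contMDiff_boundaryless (t₀ := 0) (contMDiff_leftField ξ)
    (isMIntegralCurve_leftField_iff.2 hγ.hasVelocityAt)
    (isMIntegralCurve_leftField_iff.2 hγ'.hasVelocityAt) (hγ.map_zero.trans hγ'.map_zero.symm)

/-- Left translation carries a local integral curve through `1` to one through any `g` with the same
lifetime. A uniform lifetime gives a global integral curve, and uniqueness of integral curves makes
it a homomorphism. -/
theorem exists_isOneParameterSubgroup [CompleteSpace E] (ξ : E) :
    ∃ γ : ℝ → S, IsOneParameterSubgroup γ ξ := by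
  have htrans : ∀ (g : S) {γ : ℝ → S} {t : ℝ}, HasVelocityAt γ (leftField S ξ (γ t)) t →
      HasVelocityAt (fun t => g * γ t) (leftField S ξ (g * γ t)) t := by
    intro g γ t h
    have := h.comp_mdifferentiableAt (mdifferentiable_mul_left_real g _)
    rwa [leftField_mul] at this
  obtain ⟨γ₀, h0, h1⟩ := exists_isMIntegralCurveAt_of_contMDiffAt_boundaryless (t₀ := 0)
    ((contMDiff_leftField (S := S) ξ).contMDiffAt (x := 1))
  obtain ⟨ε, hε, h1⟩ := Metric.eventually_nhds_iff_ball.1 h1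
  obtain ⟨γ, hγ0, hγ⟩ := exists_isMIntegralCurve_of_isMIntegralCurveOn
    (contMDiff_leftField (S := S) ξ) hε (fun g => ⟨fun t => g * γ₀ t, by simp [h0], by
      intro t ht
      have := htrans g (hasVelocityAt_iff_smulRight.2 (h1 t (by
        rw [Real.ball_eq_Ioo]; simpa using ht)))
      exact (hasVelocityAt_iff_smulRight.1 this).hasMFDerivWithinAt⟩) 1
  have hγv := isMIntegralCurve_leftField_iff.1 hγ
  refine ⟨γ, ?_, ?_⟩
  · intro s t
    have h2 : IsMIntegralCurve (I := 𝓘(ℝ, E)) (fun t => γ s * γ t) (leftField S ξ) :=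
      isMIntegralCurve_leftField_iff.2 fun t => htrans (γ s) (hγv t)
    have := isMIntegralCurve_Ioo_eq_of_contMDiff_boundaryless (t₀ := 0) (contMDiff_leftField ξ)
      (hγ.comp_add s) h2 (by simp [hγ0])
    have := congrFun this t
    simpa [add_comm] using this
  · have := hγv 0
    rw [hγ0, leftField_one] at this
    exact this

variable [FiniteDimensional ℂ E]

variable (S) in
-- `lieExp` is a choice made separately for each vector and read at time `1`. Rescaling time in one
-- subgroup, `s ↦ γ(st)`, and using uniqueness ties these choices together.
theorem isOneParameterSubgroup_lieExp (ξ : E) :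
    IsOneParameterSubgroup (fun t : ℝ => lieExp S (t • ξ)) ξ := by
  have := FiniteDimensional.complete ℂ E
  obtain ⟨γ, hγ⟩ := exists_isOneParameterSubgroup (S := S) ξ
  suffices h : (fun t : ℝ => lieExp S (t • ξ)) = γ by rw [h]; exact hγ
  ext t
  have h1 : IsOneParameterSubgroup (fun s => γ (s * t)) (t • ξ) :=
    { map_add := fun a b => by rw [add_mul, hγ.map_add]
      velocity := by
        have h0 : HasVelocityAt γ ξ (0 * t) := by rw [zero_mul]; exact hγ.velocity
        have h2 := h0.scomp (a := fun s => s * t) (by simpa using (hasDerivAt_id (0:ℝ)).mul_const t)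
        exact h2 }
  have h2 : ∃ γ : ℝ → S, IsOneParameterSubgroup γ (t • ξ) := ⟨_, h1⟩
  rw [lieExp, dif_pos h2, h2.choose_spec.eq h1]
  simp only [one_mul]

theorem IsOneParameterSubgroup.eq_lieExp {γ : ℝ → S} {ξ : E} (hγ : IsOneParameterSubgroup γ ξ)
    (t : ℝ) : γ t = lieExp S (t • ξ) :=
  congrFun (hγ.eq (isOneParameterSubgroup_lieExp S ξ)) t

theorem IsOneParameterSubgroup.eq_lieExp_one {γ : ℝ → S} {ξ : E}
    (hγ : IsOneParameterSubgroup γ ξ) : γ 1 = lieExp S ξ := by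
  rw [hγ.eq_lieExp, one_smul]

theorem lieExp_add_smul (ξ : E) (s t : ℝ) :
    lieExp S ((s + t) • ξ) = lieExp S (s • ξ) * lieExp S (t • ξ) :=
  (isOneParameterSubgroup_lieExp S ξ).map_add s t

theorem hasVelocityAt_lieExp_zero (ξ : E) :
    HasVelocityAt (fun t : ℝ => lieExp S (t • ξ)) ξ 0 :=
  (isOneParameterSubgroup_lieExp S ξ).velocity

theorem lieExp_zero : lieExp S (0 : E) = 1 := by
  have := (isOneParameterSubgroup_lieExp S (0 : E)).map_zero
  simpa using this

theorem lieExp_neg (ξ : E) : lieExp S (-ξ) = (lieExp S ξ)⁻¹ := by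
  have := lieExp_add_smul (S := S) ξ (-1) 1
  rw [neg_add_cancel, zero_smul, lieExp_zero] at this
  simp only [neg_smul, one_smul] at this
  exact eq_inv_of_mul_eq_one_left this.symm

/-- A Lie algebra element is determined by its one-parameter subgroup. -/
theorem eq_of_lieExp_smul_eq {ξ η : E} (h : ∀ t : ℝ, lieExp S (t • ξ) = lieExp S (t • η)) :
    ξ = η := by
  have h1 := hasVelocityAt_lieExp_zero (S := S) ξ
  rw [funext h] at h1
  exact h1.unique (hasVelocityAt_lieExp_zero η)

/-- A differentiable homomorphism intertwines the exponential maps. -/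
theorem map_lieExp (φ : S →* S) {L : E →L[ℝ] E}
    (hφ : HasMFDerivAt 𝓘(ℝ, E) 𝓘(ℝ, E) φ (1 : S) L) (ξ : E) :
    φ (lieExp S ξ) = lieExp S (L ξ) := by
  have h : IsOneParameterSubgroup (fun t : ℝ => φ (lieExp S (t • ξ))) (L ξ) :=
    { map_add := fun s t => by rw [lieExp_add_smul, map_mul]
      velocity := by
        have h0 := hasVelocityAt_lieExp_zero (S := S) ξ
        have h2 : HasMFDerivAt 𝓘(ℝ, E) 𝓘(ℝ, E) φ (lieExp S ((0 : ℝ) • ξ)) L := by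
          rw [zero_smul, lieExp_zero]; exact hφ
        exact h0.comp_hasMFDerivAt h2 }
  simpa using h.eq_lieExp_one

theorem mdifferentiable_conj (g : S) :
    MDifferentiable 𝓘(ℂ, E) 𝓘(ℂ, E) (fun h : S => g * h * g⁻¹) :=
  ((contMDiff_mul_right (I := 𝓘(ℂ, E)) (n := ω) (a := g⁻¹)).comp
    (contMDiff_mul_left (I := 𝓘(ℂ, E)) (n := ω) (a := g))).mdifferentiable (by simp)

theorem hasMFDerivAt_conj (g : S) :
    HasMFDerivAt 𝓘(ℂ, E) 𝓘(ℂ, E) (fun h : S => g * h * g⁻¹) (1 : S) (Ad g : E →L[ℂ] E) :=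
  (mdifferentiable_conj g 1).hasMFDerivAt

theorem conj_lieExp (g : S) (ξ : E) : g * lieExp S ξ * g⁻¹ = lieExp S (Ad g ξ) :=
  map_lieExp (MulAut.conj g).toMonoidHom (hasMFDerivAt_real_of_complex (hasMFDerivAt_conj g)) ξ

theorem conj_lieExp_smul (g : S) (ξ : E) (t : ℝ) :
    g * lieExp S (t • ξ) * g⁻¹ = lieExp S (t • Ad g ξ) := by
  rw [conj_lieExp]
  congr 1
  exact ((Ad g : E →L[ℂ] E).restrictScalars ℝ).map_smul t ξ

/-- Identities for `Ad` are read off from conjugated one-parameter subgroups, which determine their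
velocities; no chain rule at `1` is required. -/
theorem Ad_one : (Ad (1 : S) : E →L[ℂ] E) = ContinuousLinearMap.id ℂ E := by
  ext ξ
  refine eq_of_lieExp_smul_eq (S := S) fun t => ?_
  rw [← conj_lieExp_smul]; simp

theorem Ad_mul (g h : S) : (Ad (g * h) : E →L[ℂ] E) = (Ad g).comp (Ad h) := by
  ext ξ
  refine eq_of_lieExp_smul_eq (S := S) fun t => ?_
  rw [ContinuousLinearMap.comp_apply, ← conj_lieExp_smul, ← conj_lieExp_smul, ← conj_lieExp_smul]
  simp [mul_assoc]

theorem Ad_inv_apply_Ad (g : S) (ξ : E) : Ad g⁻¹ (Ad g ξ) = ξ := by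
  rw [← ContinuousLinearMap.comp_apply, ← Ad_mul]; simp [Ad_one]

theorem Ad_apply_Ad_inv (g : S) (ξ : E) : Ad g (Ad g⁻¹ ξ) = ξ := by
  rw [← ContinuousLinearMap.comp_apply, ← Ad_mul]; simp [Ad_one]

/-- Fixing `ξ` becomes a commutation relation in the group, to which `Θ`, conjugation and limits can
be applied. -/
theorem Ad_eq_self_iff {g : S} {ξ : E} :
    Ad g ξ = ξ ↔ ∀ t : ℝ, g * lieExp S (t • ξ) = lieExp S (t • ξ) * g := by
  constructor
  · intro h t
    have := conj_lieExp_smul g ξ t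
    rw [h] at this
    exact mul_inv_eq_iff_eq_mul.1 this
  · intro h
    refine eq_of_lieExp_smul_eq (S := S) fun t => ?_
    rw [← conj_lieExp_smul, h t]; simp

end OneParameter

/-! ### Regularity of the adjoint representation and `Ad(exp tξ) = exp(t ad ξ)` -/

section AdSmooth
variable {E : Type*} [NormedAddCommGroup E] [NormedSpace ℂ E]
  {S : Type*} [Group S] [TopologicalSpace S] [ChartedSpace E S] [LieGroup 𝓘(ℂ, E) ω S]

theorem contMDiff_Ad :
    ContMDiff 𝓘(ℂ, E) 𝓘(ℂ, E →L[ℂ] E) 1 (Ad : S → (E →L[ℂ] E)) := by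
  intro g₀
  have hf : ContMDiff (𝓘(ℂ, E).prod 𝓘(ℂ, E)) 𝓘(ℂ, E) 2
      (Function.uncurry fun g h : S => g * h * g⁻¹) :=
    (contMDiff_fst.mul contMDiff_snd).mul contMDiff_fst.inv
  have h := ContMDiffAt.mfderiv (m := 1) (fun g h : S => g * h * g⁻¹) (fun _ => (1 : S))
    (hf (g₀, 1)) (contMDiffAt_const (x := g₀)) (by norm_num)
  -- Conjugation fixes `1`, so source and target base points never move and the tangent coordinate
  -- changes are identities.
  have e : inTangentCoordinates 𝓘(ℂ, E) 𝓘(ℂ, E) (fun _ : S => (1 : S)) (fun g : S => g * 1 * g⁻¹)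
      (Ad : S → (E →L[ℂ] E)) g₀ = Ad := by
    ext g v
    rw [inTangentCoordinates_eq]
    · have h1 : ∀ w : E, (tangentBundleCore 𝓘(ℂ, E) S).coordChange
          (achart E (g * 1 * g⁻¹)) (achart E (g₀ * 1 * g₀⁻¹)) (g * 1 * g⁻¹) w = w := by
        intro w
        rw [show g * 1 * g⁻¹ = 1 by simp, show g₀ * 1 * g₀⁻¹ = 1 by simp]
        exact (tangentBundleCore 𝓘(ℂ, E) S).coordChange_self _ _ (mem_achart_source E 1) w
      have h2 : ∀ w : E, (tangentBundleCore 𝓘(ℂ, E) S).coordChange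
          (achart E (1 : S)) (achart E (1 : S)) 1 w = w := fun w =>
        (tangentBundleCore 𝓘(ℂ, E) S).coordChange_self _ _ (mem_achart_source E 1) w
      refine (h1 _).trans ?_
      exact congrArg (Ad g : E →L[ℂ] E) (h2 v)
    · exact mem_chart_source E 1
    · simp
  exact e ▸ h

theorem continuous_Ad : Continuous (Ad : S → (E →L[ℂ] E)) := contMDiff_Ad.continuous

variable (S) in
/-- The differential of the adjoint representation. -/
def ad : E →L[ℂ] (E →L[ℂ] E) := diffComplex (Ad : S → (E →L[ℂ] E)) 1

variable [T2Space S] [FiniteDimensional ℂ E]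

theorem hasDerivAt_Ad_lieExp_zero (ξ : E) :
    HasDerivAt (fun t : ℝ => (Ad (lieExp S (t • ξ)) : E →L[ℂ] E)) (ad S ξ) 0 := by
  have h1 : HasMFDerivAt 𝓘(ℂ, E) 𝓘(ℂ, E →L[ℂ] E) (Ad : S → (E →L[ℂ] E)) (1 : S)
      (ad S : E →L[ℂ] (E →L[ℂ] E)) :=
    (contMDiff_Ad.mdifferentiable one_ne_zero (1 : S)).hasMFDerivAt
  have h2 := hasMFDerivAt_real_of_complex h1
  have h0 := hasVelocityAt_lieExp_zero (S := S) ξ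
  have h3 : HasMFDerivAt 𝓘(ℝ, E) 𝓘(ℝ, E →L[ℂ] E) (Ad : S → (E →L[ℂ] E))
    (lieExp S ((0 : ℝ) • ξ))
    ((ad S : E →L[ℂ] (E →L[ℂ] E)).restrictScalars ℝ : E →L[ℝ] (E →L[ℂ] E)) := by
    rw [zero_smul, lieExp_zero]; exact h2
  exact hasVelocityAt_iff_hasDerivAt.1 (h0.comp_hasMFDerivAt h3)

theorem hasDerivAt_Ad_lieExp (ξ : E) (t : ℝ) :
    HasDerivAt (fun t : ℝ => (Ad (lieExp S (t • ξ)) : E →L[ℂ] E))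
      (ad S ξ * Ad (lieExp S (t • ξ))) t := by
  have h0 : HasDerivAt (fun t : ℝ => (Ad (lieExp S (t • ξ)) : E →L[ℂ] E)) (ad S ξ) (t - t) := by
    rw [sub_self]; exact hasDerivAt_Ad_lieExp_zero ξ
  have h1 := (HasDerivAt.scomp (h := fun s => s - t) t h0
    ((hasDerivAt_id' t).sub_const t)).mul_const (Ad (lieExp S (t • ξ)))
  rw [one_smul] at h1
  refine h1.congr_of_eventuallyEq (Filter.Eventually.of_forall fun s => ?_)
  have := lieExp_add_smul (S := S) ξ (s - t) t
  rw [sub_add_cancel] at this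
  simp only [Function.comp_apply]
  rw [this, Ad_mul]; rfl

/-- By the differential equation for `Ad(exp tξ)`, the product `exp(-t ad ξ) Ad(exp tξ)` has zero
derivative. The complex scalar in the statement is what later permits complex time. -/
theorem Ad_lieExp_smul (ξ : E) (t : ℝ) :
    (Ad (lieExp S (t • ξ)) : E →L[ℂ] E) = NormedSpace.exp ((t : ℂ) • ad S ξ) := by
  have := FiniteDimensional.complete ℂ E
  set M : E →L[ℂ] E := ad S ξ
  have hexp : ∀ t : ℝ, HasDerivAt (fun t : ℝ => NormedSpace.exp ((-t) • M))
      (-(NormedSpace.exp ((-t) • M) * M)) t := fun t => by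
    have := (hasDerivAt_exp_smul_const (𝕂 := ℝ) M (-t)).scomp t (hasDerivAt_neg t)
    simpa [Function.comp_def] using this
  have hd : ∀ t : ℝ, HasDerivAt
      (fun t : ℝ => NormedSpace.exp ((-t) • M) * Ad (lieExp S (t • ξ))) 0 t := fun t => by
    have := (hexp t).mul (hasDerivAt_Ad_lieExp (S := S) ξ t)
    refine this.congr_deriv ?_
    simp [mul_assoc, M]
  have hc := is_const_of_deriv_eq_zero (fun t => (hd t).differentiableAt)
    (fun t => (hd t).deriv) t 0
  simp only [neg_zero, zero_smul, NormedSpace.exp_zero, one_mul, lieExp_zero, Ad_one] at hc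
  have h1 : NormedSpace.exp (t • M) * NormedSpace.exp ((-t) • M) = 1 := by
    rw [neg_smul]
    have h2 : Commute (t • M) (-(t • M)) := (Commute.refl _).neg_right
    let : NormedAlgebra ℚ (E →L[ℂ] E) := NormedAlgebra.restrictScalars ℚ ℂ _
    rw [← NormedSpace.exp_add_of_commute h2, add_neg_cancel, NormedSpace.exp_zero]
  have h3 := congrArg (fun L => NormedSpace.exp (t • M) * L) hc
  simp only [← mul_assoc, h1, one_mul] at h3
  rw [h3, Complex.coe_smul]
  exact mul_one _

end AdSmooth

/-! ### Consequences of the Cartan decomposition -/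

section Cartan
variable {E : Type*} [NormedAddCommGroup E] [NormedSpace ℂ E] [FiniteDimensional ℂ E]
  {S : Type*} [Group S] [TopologicalSpace S] [ChartedSpace E S] [LieGroup 𝓘(ℂ, E) ω S] [T2Space S]
  {Θ : S ≃* S}

theorem mem_iu_iff {ξ : E} : ξ ∈ iu Θ ↔ (diffReal Θ (1 : S) : E →L[ℝ] E) ξ = -ξ := Iff.rfl

theorem mem_fixedSubgroup_iff {g : S} : g ∈ fixedSubgroup Θ ↔ Θ g = g := Iff.rfl

namespace IsCartanInvolution

theorem map_lieExp_eq (hΘ : IsCartanInvolution E Θ) (ξ : E) :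
    Θ (lieExp S ξ) = lieExp S ((diffReal Θ (1 : S) : E →L[ℝ] E) ξ) :=
  map_lieExp Θ.toMonoidHom (L := diffReal Θ (1 : S))
    (hΘ.smooth.mdifferentiable (by simp) 1).hasMFDerivAt ξ

theorem map_lieExp_of_mem (hΘ : IsCartanInvolution E Θ)
    {α : E} (hα : α ∈ iu Θ) : Θ (lieExp S α) = (lieExp S α)⁻¹ := by
  rw [hΘ.map_lieExp_eq, mem_iu_iff.1 hα, lieExp_neg]

theorem mem_iu_of_map_lieExp (hΘ : IsCartanInvolution E Θ) {α : E}
    (h : ∀ t : ℝ, Θ (lieExp S (t • α)) = (lieExp S (t • α))⁻¹) : α ∈ iu Θ := by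
  refine mem_iu_iff.2 (eq_of_lieExp_smul_eq (S := S) fun t => ?_)
  rw [← map_smul, ← hΘ.map_lieExp_eq, h, smul_neg, lieExp_neg]

/-- Antiholomorphy turns the eigenvalue `-1` of `dΘ` on `α` into `+1` on `iα`. These elements
provide the compact directions used throughout. -/
theorem lieExp_I_smul_mem (hΘ : IsCartanInvolution E Θ) {α : E} (hα : α ∈ iu Θ) :
    lieExp S (Complex.I • α) ∈ fixedSubgroup Θ := by
  rw [mem_fixedSubgroup_iff, hΘ.map_lieExp_eq, hΘ.antiholomorphic, mem_iu_iff.1 hα, smul_neg,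
    neg_neg]

theorem lieExp_smul_I_smul_mem (hΘ : IsCartanInvolution E Θ) {α : E} (hα : α ∈ iu Θ) (t : ℝ) :
    lieExp S (t • Complex.I • α) ∈ fixedSubgroup Θ := by
  rw [smul_comm]
  exact hΘ.lieExp_I_smul_mem ((iu Θ).smul_mem t hα)

theorem Ad_mem_iu (hΘ : IsCartanInvolution E Θ)
    {u : S} (hu : u ∈ fixedSubgroup Θ) {α : E} (hα : α ∈ iu Θ) :
    Ad u α ∈ iu Θ := by
  refine hΘ.mem_iu_of_map_lieExp fun t => ?_
  rw [← conj_lieExp_smul, map_mul, map_mul, map_inv, mem_fixedSubgroup_iff.1 hu,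
    hΘ.map_lieExp_of_mem ((iu Θ).smul_mem t hα)]
  group

theorem eq_of_mul_lieExp_eq (hΘ : IsCartanInvolution E Θ)
    {u v : S} (hu : u ∈ fixedSubgroup Θ) (hv : v ∈ fixedSubgroup Θ)
    {α β : E} (hα : α ∈ iu Θ) (hβ : β ∈ iu Θ) (h : u * lieExp S α = v * lieExp S β) :
    u = v ∧ α = β := by
  have := hΘ.cartan.injective (a₁ := (⟨u, hu⟩, ⟨α, hα⟩)) (a₂ := (⟨v, hv⟩, ⟨β, hβ⟩)) h
  simpa using this

theorem eq_of_lieExp_eq (hΘ : IsCartanInvolution E Θ) {α β : E} (hα : α ∈ iu Θ) (hβ : β ∈ iu Θ)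
    (h : lieExp S α = lieExp S β) : α = β :=
  (hΘ.eq_of_mul_lieExp_eq (one_mem _) (one_mem _) hα hβ (by rw [h])).2

/-- An element fixing `β ∈ i𝔲` has both Cartan factors fixing `β`. -/
theorem Ad_factors_eq_self (hΘ : IsCartanInvolution E Θ)
    {β : E} (hβ : β ∈ iu Θ) {k : S} (hk : k ∈ fixedSubgroup Θ)
    {α : E} (hα : α ∈ iu Θ) (h : Ad (k * lieExp S α) β = β) :
    Ad k β = β ∧ ∀ s : ℝ, Ad (lieExp S (s • α)) β = β := by
  -- `Θ` sends `k exp α` to `k exp(-α)` and `exp(-tβ)` to `exp(tβ)`, so applying it to the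
  -- commutation relation at `-t` gives the one at `t`.
  have h1 : Ad (k * (lieExp S α)⁻¹) β = β := by
    rw [Ad_eq_self_iff] at h ⊢
    intro t
    have h2 := congrArg Θ (h (-t))
    rw [map_mul, map_mul, map_mul, map_mul, hΘ.map_lieExp_of_mem hα,
      hΘ.map_lieExp_of_mem ((iu Θ).smul_mem _ hβ), mem_fixedSubgroup_iff.1 hk, neg_smul,
      lieExp_neg, inv_inv] at h2
    exact h2
  have h2 : lieExp S ((2 : ℝ) • α) = lieExp S α * lieExp S α := by
    have := lieExp_add_smul (S := S) α 1 1
    rw [one_smul] at this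
    rw [← this]; norm_num
  have h3 : k * lieExp S α = k * (lieExp S α)⁻¹ * lieExp S ((2 : ℝ) • α) := by
    rw [h2]; group
  have h4 : Ad (lieExp S ((2 : ℝ) • α)) β = β := by
    rw [h3, Ad_mul, ContinuousLinearMap.comp_apply] at h
    have := congrArg (Ad (k * (lieExp S α)⁻¹)⁻¹) (h.trans h1.symm)
    rwa [Ad_inv_apply_Ad, Ad_inv_apply_Ad] at this
  have h5 : Ad (lieExp S ((2 : ℝ) • α)) (Complex.I • β) = Complex.I • β := by
    rw [map_smul, h4]
  -- `exp(2α)` commutes with `u = exp(tiβ) ∈ U`, so `exp(2 Ad(u)α) = exp(2α)`; injectivity of `exp`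
  -- on `i𝔲` extracts `Ad(u)α = α`.
  have h6 : ∀ t : ℝ, Ad (lieExp S (t • Complex.I • β)) α = α := by
    intro t
    have hu := hΘ.lieExp_smul_I_smul_mem hβ t
    have h7 := Ad_eq_self_iff.1 h5 t
    have h8 : lieExp S ((2 : ℝ) • Ad (lieExp S (t • Complex.I • β)) α) =
        lieExp S ((2 : ℝ) • α) := by
      rw [← conj_lieExp_smul, ← h7]; group
    have h9 := hΘ.eq_of_lieExp_eq ((iu Θ).smul_mem _ (hΘ.Ad_mem_iu hu hα))
      ((iu Θ).smul_mem _ hα) h8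
    exact smul_right_injective E (two_ne_zero (α := ℝ)) h9
  -- The relation is now read with the roles exchanged: `exp(sα)` commutes with every `exp(tiβ)`,
  -- hence fixes `iβ`, and by complex linearity `β`.
  have h10 : ∀ s : ℝ, Ad (lieExp S (s • α)) β = β := by
    intro s
    have : Ad (lieExp S (s • α)) (Complex.I • β) = Complex.I • β :=
      Ad_eq_self_iff.2 fun t => (Ad_eq_self_iff.1 (h6 t) s).symm
    rw [map_smul] at this
    exact smul_right_injective E Complex.I_ne_zero this
  refine ⟨?_, h10⟩
  rw [Ad_mul, ContinuousLinearMap.comp_apply] at h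
  have h11 := h10 1
  rw [one_smul] at h11
  rwa [h11] at h

/-- If the conjugates `exp(tβ) g exp(-tβ)` converge for `t → ±∞`, then `Ad` takes the same value
at `g` and at the limits. -/
theorem Ad_eq_of_tendsto_conj (hΘ : IsCartanInvolution E Θ) {β : E} (hβ : β ∈ iu Θ) {g a b : S}
    (ha : Filter.Tendsto (fun t : ℝ => lieExp S (t • β) * g * lieExp S (-(t • β)))
      Filter.atTop (𝓝 a))
    (hb : Filter.Tendsto (fun t : ℝ => lieExp S (t • β) * g * lieExp S (-(t • β)))
      Filter.atBot (𝓝 b)) : (Ad g : E →L[ℂ] E) = Ad a := by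
  have := FiniteDimensional.complete ℂ E
  let : NormedAlgebra ℚ (E →L[ℂ] E) := NormedAlgebra.restrictScalars ℚ ℂ _
  set M : E →L[ℂ] E := ad S β with hM
  -- The entire extension to complex time of `Ad(exp(tβ) g exp(-tβ))`.
  set f : ℂ → (E →L[ℂ] E) := fun w => NormedSpace.exp (w • M) * Ad g * NormedSpace.exp ((-w) • M)
    with hf
  have hreal : ∀ t : ℝ, f t = Ad (lieExp S (t • β) * g * lieExp S (-(t • β))) := by
    intro t
    rw [Ad_mul, Ad_mul, ← neg_smul, Ad_lieExp_smul, Ad_lieExp_smul]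
    simp only [hf, Complex.ofReal_neg]
    rfl
  have hfd : Differentiable ℂ f := by
    intro w
    have h1 := hasDerivAt_exp_smul_const (𝕂 := ℂ) M w
    have h2 := (hasDerivAt_exp_smul_const (𝕂 := ℂ) M (-w)).scomp w (hasDerivAt_neg w)
    exact ((h1.mul_const (Ad g)).mul h2).differentiableAt
  have hra : Filter.Tendsto (fun t : ℝ => f t) Filter.atTop (𝓝 (Ad a)) := by
    simp only [hreal]
    exact (continuous_Ad.tendsto a).comp ha
  have hrb : Filter.Tendsto (fun t : ℝ => f t) Filter.atBot (𝓝 (Ad b)) := by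
    simp only [hreal]
    exact (continuous_Ad.tendsto b).comp hb
  -- On the real line boundedness comes from the limits at both ends and compactness in between.
  obtain ⟨C, hC⟩ : ∃ C, ∀ t : ℝ, ‖f t‖ ≤ C := by
    obtain ⟨t₁, h1⟩ := Filter.eventually_atTop.1
      (hra.norm.eventually_le_const (lt_add_one ‖(Ad a : E →L[ℂ] E)‖))
    obtain ⟨t₂, h2⟩ := Filter.eventually_atBot.1
      (hrb.norm.eventually_le_const (lt_add_one ‖(Ad b : E →L[ℂ] E)‖))
    obtain ⟨C, h3⟩ := (isCompact_Icc (a := t₂) (b := t₁)).exists_bound_of_continuousOn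
      (f := fun t : ℝ => f t) (hfd.continuous.comp Complex.continuous_ofReal).continuousOn
    refine ⟨max C (max (‖(Ad a : E →L[ℂ] E)‖ + 1) (‖(Ad b : E →L[ℂ] E)‖ + 1)), fun t => ?_⟩
    rcases le_total t₁ t with h | h
    · exact (h1 t h).trans ((le_max_left _ _).trans (le_max_right _ _))
    rcases le_total t t₂ with h' | h'
    · exact (h2 t h').trans ((le_max_right _ _).trans (le_max_right _ _))
    · exact (h3 t ⟨h', h⟩).trans (le_max_left _ _)
  obtain ⟨D, hD⟩ := hΘ.compact.exists_bound_of_continuousOn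
    (f := (Ad : S → (E →L[ℂ] E))) continuous_Ad.continuousOn
  -- In imaginary time the exponential is `Ad(exp(siβ))`, which stays in the compact set `Ad(U)`.
  have himag : ∀ s : ℝ, ‖NormedSpace.exp (((s : ℂ) * Complex.I) • M)‖ ≤ D := by
    intro s
    have := hD _ (hΘ.lieExp_smul_I_smul_mem hβ s)
    rwa [Ad_lieExp_smul, map_smul, smul_smul] at this
  have hbd : ∀ w, ‖f w‖ ≤ D * C * D := by
    intro w
    have hw : ∀ z : ℂ, NormedSpace.exp (z • M) = NormedSpace.exp (((z.im : ℂ) * Complex.I) • M) *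
        NormedSpace.exp ((z.re : ℂ) • M) := fun z => by
      rw [← NormedSpace.exp_add_of_commute (((Commute.refl M).smul_left _).smul_right _),
        ← add_smul, add_comm, Complex.re_add_im]
    have hw' : ∀ z : ℂ, NormedSpace.exp (z • M) = NormedSpace.exp ((z.re : ℂ) • M) *
        NormedSpace.exp (((z.im : ℂ) * Complex.I) • M) := fun z => by
      rw [← NormedSpace.exp_add_of_commute (((Commute.refl M).smul_left _).smul_right _),
        ← add_smul, Complex.re_add_im]
    have h1 : f w = NormedSpace.exp (((w.im : ℂ) * Complex.I) • M) * f w.re *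
        NormedSpace.exp ((((-w.im : ℝ) : ℂ) * Complex.I) • M) := by
      simp only [hf]
      rw [hw w, hw' (-w)]
      simp only [Complex.neg_re, Complex.neg_im, Complex.ofReal_neg, mul_assoc]
    have hD0 : 0 ≤ D := (norm_nonneg _).trans (himag 0)
    have hC0 : 0 ≤ C := (norm_nonneg _).trans (hC 0)
    rw [h1]
    refine (norm_mul_le _ _).trans (mul_le_mul ((norm_mul_le _ _).trans
      (mul_le_mul (himag _) (hC _) (norm_nonneg _) hD0)) (himag _) (norm_nonneg _)
      (mul_nonneg hD0 hC0))
  -- Liouville's theorem: `f` is constant, so its value `Ad g` at `0` equals its limit at `+∞`.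
  have hconst := fun z => hfd.apply_eq_apply_of_bounded
    (isBounded_iff_forall_norm_le.2 ⟨D * C * D, by rintro _ ⟨w, rfl⟩; exact hbd w⟩) z 0
  have h0 : f 0 = Ad g := by
    have := hreal 0
    simpa [lieExp_zero] using this
  have h2 : Filter.Tendsto (fun t : ℝ => f t) Filter.atTop (𝓝 (Ad g)) := by
    simp only [hconst, h0]
    exact tendsto_const_nhds
  exact tendsto_nhds_unique h2 hra

end IsCartanInvolution
end Cartan

/-! ### Fundamental vector fields of the action -/

section Action
variable {E : Type*} [NormedAddCommGroup E] [NormedSpace ℂ E]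
  {S : Type*} [Group S] [TopologicalSpace S] [ChartedSpace E S] [LieGroup 𝓘(ℂ, E) ω S]
  {F : Type*} [NormedAddCommGroup F] [NormedSpace ℂ F]
  {Z : Type*} [TopologicalSpace Z] [ChartedSpace F Z] [IsManifold 𝓘(ℂ, F) ω Z]
  [MulAction S Z]

theorem fundVec_smul (c : ℂ) (ξ : E) (z : Z) :
    fundVec S F (c • ξ) z = c • fundVec S F ξ z :=
  (diffComplex (fun g : S => g • z) 1 : E →L[ℂ] F).map_smul c ξ

theorem contMDiff_smul_const
    (hact : ContMDiff (𝓘(ℂ, E).prod 𝓘(ℂ, F)) 𝓘(ℂ, F) ω (fun q : S × Z => q.1 • q.2)) (z : Z) :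
    ContMDiff 𝓘(ℂ, E) 𝓘(ℂ, F) ω (fun g : S => g • z) :=
  hact.comp (contMDiff_id.prodMk contMDiff_const)

theorem contMDiff_const_smul_action
    (hact : ContMDiff (𝓘(ℂ, E).prod 𝓘(ℂ, F)) 𝓘(ℂ, F) ω (fun q : S × Z => q.1 • q.2)) (g : S) :
    ContMDiff 𝓘(ℂ, F) 𝓘(ℂ, F) ω (fun z : Z => g • z) :=
  hact.comp (contMDiff_const.prodMk contMDiff_id)

variable [FiniteDimensional ℂ E] [T2Space S]

theorem hasVelocityAt_lieExp_smul_zero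
    (hact : ContMDiff (𝓘(ℂ, E).prod 𝓘(ℂ, F)) 𝓘(ℂ, F) ω (fun q : S × Z => q.1 • q.2))
    (ξ : E) (z : Z) :
    HasVelocityAt (fun t : ℝ => lieExp S (t • ξ) • z) (fundVec S F ξ z) 0 := by
  have h1 : HasMFDerivAt 𝓘(ℂ, E) 𝓘(ℂ, F) (fun g : S => g • z) 1
      (diffComplex (fun g : S => g • z) 1 : E →L[ℂ] F) :=
    ((contMDiff_smul_const hact z).mdifferentiable (by simp) 1).hasMFDerivAt
  have h2 := hasMFDerivAt_real_of_complex h1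
  have h3 : HasMFDerivAt 𝓘(ℝ, E) 𝓘(ℝ, F) (fun g : S => g • z) (lieExp S ((0 : ℝ) • ξ))
      ((diffComplex (fun g : S => g • z) 1 : E →L[ℂ] F).restrictScalars ℝ) := by
    rw [zero_smul, lieExp_zero]; exact h2
  exact (hasVelocityAt_lieExp_zero (S := S) ξ).comp_hasMFDerivAt h3

theorem hasVelocityAt_lieExp_smul
    (hact : ContMDiff (𝓘(ℂ, E).prod 𝓘(ℂ, F)) 𝓘(ℂ, F) ω (fun q : S × Z => q.1 • q.2))
    (ξ : E) (z : Z) (t : ℝ) :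
    HasVelocityAt (fun t : ℝ => lieExp S (t • ξ) • z)
      (fundVec S F ξ (lieExp S (t • ξ) • z)) t := by
  have h0 : HasVelocityAt (fun s : ℝ => lieExp S (s • ξ) • lieExp S (t • ξ) • z)
      (fundVec S F ξ (lieExp S (t • ξ) • z)) (t - t) := by
    rw [sub_self]; exact hasVelocityAt_lieExp_smul_zero hact ξ _
  have h1 := h0.scomp (a := fun s => s - t) ((hasDerivAt_id' t).sub_const t)
  have h2 : (fun s : ℝ => lieExp S ((s - t) • ξ) • lieExp S (t • ξ) • z) =
      fun s : ℝ => lieExp S (s • ξ) • z := by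
    ext s
    rw [← mul_smul, ← lieExp_add_smul, sub_add_cancel]
  rw [h2, one_smul] at h1
  exact h1

theorem fundVec_eq_zero_of_fixed
    (hact : ContMDiff (𝓘(ℂ, E).prod 𝓘(ℂ, F)) 𝓘(ℂ, F) ω (fun q : S × Z => q.1 • q.2))
    {ξ : E} {z : Z} (h : ∀ t : ℝ, lieExp S (t • ξ) • z = z) : fundVec S F ξ z = 0 := by
  have h1 := hasVelocityAt_lieExp_smul_zero hact ξ z
  simp only [h] at h1
  have key : (0 : ℝ →L[ℝ] F) = ContinuousLinearMap.toSpanSingleton ℝ (0 : F) := by ext; simp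
  have h2 : HasVelocityAt (fun _ : ℝ => z) (0 : F) 0 :=
    (hasMFDerivAt_const (I := 𝓘(ℝ, ℝ)) (I' := 𝓘(ℝ, F)) z (0 : ℝ)).congr_mfderiv key
  exact h1.unique h2

/-- The velocity of `exp(tξ)z` at time `t` is the image under `exp(tξ)` of the velocity at time `0`,
hence zero. -/
theorem lieExp_smul_eq_self [T2Space Z]
    (hact : ContMDiff (𝓘(ℂ, E).prod 𝓘(ℂ, F)) 𝓘(ℂ, F) ω (fun q : S × Z => q.1 • q.2))
    {ξ : E} {z : Z} (h : fundVec S F ξ z = 0) (t : ℝ) : lieExp S (t • ξ) • z = z := by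
  have hv : ∀ t : ℝ, HasVelocityAt (fun t : ℝ => lieExp S (t • ξ) • z) (0 : F) t := by
    intro t
    have h0 : HasVelocityAt (fun s : ℝ => lieExp S (s • ξ) • z) (0 : F) (t - t) := by
      rw [sub_self, ← h]; exact hasVelocityAt_lieExp_smul_zero hact ξ _
    have h1 := h0.scomp (a := fun s => s - t) ((hasDerivAt_id' t).sub_const t)
    have h3 := h1.comp_mdifferentiableAt (f := fun z : Z => lieExp S (t • ξ) • z)
      ((contMDiff_real_of_complex
        (contMDiff_const_smul_action hact (lieExp S (t • ξ)))).mdifferentiable (by simp) _)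
    have h2 : (fun s : ℝ => lieExp S (t • ξ) • lieExp S ((s - t) • ξ) • z) =
        fun s : ℝ => lieExp S (s • ξ) • z := by
      ext s
      rw [← mul_smul, ← lieExp_add_smul, add_sub_cancel]
    rw [h2, smul_zero, map_zero] at h3
    exact h3
  have := constant_of_hasVelocityAt_zero hv t 0
  simpa [lieExp_zero] using this

theorem RiemMetric.ip_self_nonneg (h : RiemMetric F Z) (z : Z) (v : F) : 0 ≤ h.ip z v v := by
  by_cases hv : v = 0
  · subst hv
    exact ((h.inner z 0).map_zero).ge
  · exact (h.pos z v hv).le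

theorem RiemMetric.ip_self_eq_zero (h : RiemMetric F Z) {z : Z} {v : F} (hv : h.ip z v v = 0) :
    v = 0 := by
  by_contra hne
  exact (h.pos z v hne).ne' hv

theorem RiemMetric.ip_zero_left (h : RiemMetric F Z) (z : Z) (v : F) : h.ip z 0 v = 0 := by
  have h1 : h.inner z 0 = 0 := (h.inner z).map_zero
  exact (congrArg (fun L : F →L[ℝ] ℝ => L v) h1)

/-! ### Momentum components along one-parameter orbits -/

section Momentum
variable {Θ : S ≃* S} {B : LinearMap.BilinForm ℝ E} {h : RiemMetric F Z} {μ : Z → E}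

theorem IsMomentumMap.contMDiff_component (hμ : IsMomentumMap Θ B h μ) (α : E) :
    ContMDiff 𝓘(ℝ, F) 𝓘(ℝ, ℝ) ∞ (fun z => B (μ z) α) := by
  have : FiniteDimensional ℝ E := FiniteDimensional.complexToReal E
  exact (LinearMap.toContinuousLinearMap (B.flip α)).contMDiff.comp hμ.smooth

theorem IsMomentumMap.continuous_component (hμ : IsMomentumMap Θ B h μ) (α : E) :
    Continuous (fun z => B (μ z) α) := (hμ.contMDiff_component α).continuous

theorem IsMomentumMap.hasDerivAt (hμ : IsMomentumMap Θ B h μ)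
    (hact : ContMDiff (𝓘(ℂ, E).prod 𝓘(ℂ, F)) 𝓘(ℂ, F) ω (fun q : S × Z => q.1 • q.2))
    {α : E} (hα : α ∈ iu Θ) (ξ : E) (z : Z) (t : ℝ) :
    HasDerivAt (fun t : ℝ => B (μ (lieExp S (t • ξ) • z)) α)
      (h.ip (lieExp S (t • ξ) • z) (fundVec S F α (lieExp S (t • ξ) • z))
        (fundVec S F ξ (lieExp S (t • ξ) • z))) t := by
  have h1 := (hasVelocityAt_lieExp_smul hact ξ z t).comp_mdifferentiableAt
    ((hμ.contMDiff_component α).mdifferentiable (by simp) _)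
  rw [hμ.gradient α hα] at h1
  exact hasVelocityAt_iff_hasDerivAt.1 h1

/-- The derivative is `|α_Z|²`, because the flow of `α` is the gradient flow of `μ^α`. -/
theorem IsMomentumMap.monotone (hμ : IsMomentumMap Θ B h μ)
    (hact : ContMDiff (𝓘(ℂ, E).prod 𝓘(ℂ, F)) 𝓘(ℂ, F) ω (fun q : S × Z => q.1 • q.2))
    {α : E} (hα : α ∈ iu Θ) (z : Z) :
    Monotone (fun t : ℝ => B (μ (lieExp S (t • α) • z)) α) :=
  monotone_of_hasDerivAt_nonneg (fun t => hμ.hasDerivAt hact hα α z t)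
    fun _ => h.ip_self_nonneg _ _

/-- If `μ^α` takes the same value at `z` and at `exp(tα)z` for some `t > 0`, then `α_Z(z) = 0`. -/
theorem IsMomentumMap.fundVec_eq_zero (hμ : IsMomentumMap Θ B h μ)
    (hact : ContMDiff (𝓘(ℂ, E).prod 𝓘(ℂ, F)) 𝓘(ℂ, F) ω (fun q : S × Z => q.1 • q.2))
    {α : E} (hα : α ∈ iu Θ) {z : Z} {t : ℝ} (ht : 0 < t)
    (hz : B (μ (lieExp S (t • α) • z)) α ≤ B (μ z) α) : fundVec S F α z = 0 := by
  have hm := hμ.monotone hact hα z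
  have h0 : B (μ z) α = B (μ (lieExp S ((0 : ℝ) • α) • z)) α := by simp [lieExp_zero]
  have hd := hμ.hasDerivAt hact hα α z 0
  -- By monotonicity and `hz`, `μ^α` is constant on `[0, t)`, so its right derivative `|α_Z(z)|²` at
  -- `0` vanishes.
  have hc : HasDerivWithinAt (fun t : ℝ => B (μ (lieExp S (t • α) • z)) α) 0 (Set.Ici 0) 0 := by
    refine ((hasDerivAt_const (0 : ℝ) (B (μ z) α)).hasDerivWithinAt).congr_of_eventuallyEq ?_ ?_
    · filter_upwards [self_mem_nhdsWithin, mem_nhdsWithin_of_mem_nhds (Iio_mem_nhds ht)]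
        with s hs hst
      refine le_antisymm ((hm (le_of_lt hst)).trans hz) ?_
      rw [h0]
      exact hm hs
    · exact h0.symm
  have := (uniqueDiffWithinAt_Ici (0 : ℝ)).eq_deriv _ hd.hasDerivWithinAt hc
  have h2 := h.ip_self_eq_zero this
  simpa [lieExp_zero] using h2

end Momentum
end Action

/-! ### Linearizing a compact group action near a fixed point -/

section Linearization
variable {V : Type*} [NormedAddCommGroup V] [NormedSpace ℝ V] [FiniteDimensional ℝ V]

/-- A function that is critical at the fixed points of a local action of a compact group is
constant on the fixed points near a given one. -/
theorem eventually_eq_of_critical_of_linearization {ι : Type*} {φ : ι → V → V} {y₀ : V}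
    {L : ι → V →L[ℝ] V}
    {ψ : V → V} {f : V → ℝ} (hψ : HasStrictFDerivAt ψ (ContinuousLinearMap.id ℝ V) y₀)
    (hψ₀ : ψ y₀ = 0) (heq : ∀ᶠ y in 𝓝 y₀, ∀ v, ψ (φ v y) = L v (ψ y))
    (hφ : ∀ s ∈ 𝓝 y₀, ∀ᶠ y in 𝓝 y₀, ∀ u, φ u y ∈ s)
    (hf : ∀ᶠ y in 𝓝 y₀, (∀ u, φ u y = y) → HasFDerivAt f (0 : V →L[ℝ] ℝ) y) :
    ∀ᶠ y in 𝓝 y₀, (∀ u, φ u y = y) → f y = f y₀ := by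
  have hψ' : HasStrictFDerivAt ψ ((ContinuousLinearEquiv.refl ℝ V : V ≃L[ℝ] V) : V →L[ℝ] V) y₀ :=
    hψ
  set θ := hψ'.localInverse ψ _ y₀
  have hθ₀ : θ 0 = y₀ := by rw [← hψ₀]; exact hψ'.localInverse_apply_image
  have hθc : Filter.Tendsto θ (𝓝 0) (𝓝 y₀) := by rw [← hψ₀]; exact hψ'.localInverse_tendsto
  obtain ⟨K, s, hs, hK⟩ := hψ'.to_localInverse.exists_lipschitzOnWith
  have hright := hψ'.eventually_right_inverse
  rw [hψ₀] at hs hright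
  have hleft : ∀ᶠ y in 𝓝 y₀, θ (ψ y) = y := hψ'.eventually_left_inverse
  have hgood := hθc.eventually (heq.and (hf.and (hleft.and (hφ _ hleft))))
  obtain ⟨r, hr, hball⟩ := Metric.eventually_nhds_iff_ball.1 ((hgood.and hright).and hs)
  have hsmall : ∀ᶠ y in 𝓝 y₀, ψ y ∈ Metric.ball (0 : V) r := by
    have : Filter.Tendsto ψ (𝓝 y₀) (𝓝 0) := by rw [← hψ₀]; exact hψ.continuousAt
    exact this.eventually (Metric.ball_mem_nhds 0 hr)
  filter_upwards [heq, hleft, hsmall] with y hy hly hsy hfix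
  have hmem : ∀ t ∈ Set.Icc (0 : ℝ) 1, t • ψ y ∈ Metric.ball (0 : V) r := by
    intro t ht
    rw [mem_ball_zero_iff] at hsy ⊢
    rw [norm_smul, Real.norm_of_nonneg ht.1]
    exact (mul_le_of_le_one_left (norm_nonneg _) ht.2).trans_lt hsy
  have hLy : ∀ v, L v (ψ y) = ψ y := fun v => by rw [← hy v, hfix v]
  -- The segment from `0` to `ψ y` consists of `L`-fixed vectors, so its image under the local
  -- inverse `θ` consists of fixed points, where `f` is critical.
  have hder : ∀ t ∈ Set.Icc (0 : ℝ) 1, HasDerivAt (fun t : ℝ => f (θ (t • ψ y))) 0 t := by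
    intro t ht
    obtain ⟨⟨⟨h1, h2, -, h4⟩, h5⟩, -⟩ := hball _ (hmem t ht)
    have hcf : ∀ u, φ u (θ (t • ψ y)) = θ (t • ψ y) := by
      intro u
      have h6 := h4 u
      simp only [Set.mem_ofPred_eq] at h6
      rw [← h6, h1 u, h5, map_smul, hLy]
    have h7 := (h2 hcf).isLittleO
    -- Only a Lipschitz bound on `θ` is available away from `0`. It suffices: a zero derivative of
    -- `f` composed with a Lipschitz curve has zero derivative.
    have hlip : (fun t' : ℝ => θ (t' • ψ y) - θ (t • ψ y)) =O[𝓝 t] fun t' => t' - t := by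
      refine Asymptotics.IsBigO.of_bound (K * ‖ψ y‖) ?_
      have hev : ∀ᶠ t' : ℝ in 𝓝 t, t' • ψ y ∈ Metric.ball (0 : V) r :=
        (continuous_id.smul continuous_const).continuousAt.eventually
          (Metric.isOpen_ball.mem_nhds (hmem t ht))
      filter_upwards [hev] with t' ht'
      have := hK.dist_le_mul _ (hball _ ht').2 _ (hball _ (hmem t ht)).2
      rw [dist_eq_norm, dist_eq_norm, ← sub_smul, norm_smul] at this
      linarith
    have htend : Filter.Tendsto (fun t' : ℝ => θ (t' • ψ y)) (𝓝 t) (𝓝 (θ (t • ψ y))) := by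
      have h8 : Filter.Tendsto (fun t' : ℝ => t' - t) (𝓝 t) (𝓝 0) := by
        have : Continuous fun t' : ℝ => t' - t := by fun_prop
        simpa using this.tendsto t
      have := hlip.trans_tendsto h8
      simpa using this.add_const (θ (t • ψ y))
    rw [hasDerivAt_iff_isLittleO]
    have h9 := (h7.comp_tendsto htend).trans_isBigO hlip
    simpa [Function.comp_def] using h9
  have hconst := constant_of_has_deriv_right_zero (f := fun t : ℝ => f (θ (t • ψ y)))
    (a := 0) (b := 1) (fun t ht => (hder t ht).continuousAt.continuousWithinAt)
    (fun t ht => (hder t ⟨ht.1, ht.2.le⟩).hasDerivWithinAt) 1 (by simp)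
  simpa [hly, hθ₀] using hconst

variable {T : Type*} [Group T] [TopologicalSpace T] [IsTopologicalGroup T] [CompactSpace T]

/-- Linearization of a local action of a compact group near a fixed point, by averaging. -/
theorem exists_linearization {φ : T → V → V} {y₀ : V} {L : T → V →L[ℝ] V}
    (hfix : ∀ u, φ u y₀ = y₀)
    (hmul : ∀ᶠ y in 𝓝 y₀, ∀ u v, φ (u * v) y = φ u (φ v y))
    (hcont : ∀ᶠ y in 𝓝 y₀, Continuous fun u => φ u y)
    (hL : Continuous L) (hLmul : ∀ u v, L (u * v) = (L u).comp (L v))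
    (hLone : L 1 = ContinuousLinearMap.id ℝ V)
    (hstrict : ∀ ε > 0, ∀ᶠ q : V × V in 𝓝 (y₀, y₀), ∀ u,
      ‖φ u q.1 - φ u q.2 - L u (q.1 - q.2)‖ ≤ ε * ‖q.1 - q.2‖) :
    ∃ ψ : V → V, HasStrictFDerivAt ψ (ContinuousLinearMap.id ℝ V) y₀ ∧ ψ y₀ = 0 ∧
      ∀ᶠ y in 𝓝 y₀, ∀ v, ψ (φ v y) = L v (ψ y) := by
  let : MeasurableSpace T := borel T
  have : BorelSpace T := ⟨rfl⟩
  have := FiniteDimensional.proper ℝ V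
  let m : MeasureTheory.Measure T :=
    MeasureTheory.Measure.haarMeasure (⊤ : TopologicalSpace.PositiveCompacts T)
  have hm : MeasureTheory.IsProbabilityMeasure m :=
    ⟨MeasureTheory.Measure.haarMeasure_self (K₀ := (⊤ : TopologicalSpace.PositiveCompacts T))⟩
  have hint : ∀ f : T → V, Continuous f → MeasureTheory.Integrable f m := fun f hf =>
    hf.integrable_of_hasCompactSupport (HasCompactSupport.of_compactSpace f)
  have hci : ∀ᶠ y in 𝓝 y₀, Continuous fun u => L u (φ u⁻¹ y - y₀) := hcont.mono fun y hy =>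
    hL.clm_apply ((hy.comp continuous_inv).sub continuous_const)
  obtain ⟨C, hC⟩ := (isCompact_univ (X := T)).exists_bound_of_continuousOn hL.continuousOn
  have hC' : ∀ u, ‖L u‖ ≤ |C| + 1 := fun u =>
    (hC u trivial).trans ((le_abs_self C).trans (by linarith))
  have hLinv : ∀ u v, L u (L u⁻¹ v) = v := fun u v => by
    rw [← ContinuousLinearMap.comp_apply, ← hLmul, mul_inv_cancel, hLone]; rfl
  -- Bochner's average. Each integrand has derivative `L u ∘ L u⁻¹ = id` at `y₀`, and the measure
  -- has mass one, so the average has derivative `id`.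
  refine ⟨fun y => ∫ u, L u (φ u⁻¹ y - y₀) ∂m, ?_, by simp [hfix], ?_⟩
  · refine .of_isLittleO (Asymptotics.isLittleO_iff.2 fun c hc => ?_)
    have hpos : 0 < |C| + 1 := by positivity
    have hci2 : ∀ᶠ q : V × V in 𝓝 (y₀, y₀), (Continuous fun u => L u (φ u⁻¹ q.1 - y₀)) ∧
        Continuous fun u => L u (φ u⁻¹ q.2 - y₀) := by
      rw [nhds_prod_eq]
      exact hci.prod_mk hci
    filter_upwards [hstrict (c / (|C| + 1)) (by positivity), hci2] with q hq ⟨hq1, hq2⟩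
    have h1 : (∫ u, L u (φ u⁻¹ q.1 - y₀) ∂m) - (∫ u, L u (φ u⁻¹ q.2 - y₀) ∂m)
        - ContinuousLinearMap.id ℝ V (q.1 - q.2) =
        ∫ u, L u (φ u⁻¹ q.1 - φ u⁻¹ q.2 - L u⁻¹ (q.1 - q.2)) ∂m := by
      have h2 : ContinuousLinearMap.id ℝ V (q.1 - q.2) = ∫ _ : T, (q.1 - q.2) ∂m := by simp
      rw [h2, ← MeasureTheory.integral_sub (hint _ hq1) (hint _ hq2),
        ← MeasureTheory.integral_sub
          (hint (fun u => L u (φ u⁻¹ q.1 - y₀) - L u (φ u⁻¹ q.2 - y₀)) (hq1.sub hq2))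
          (MeasureTheory.integrable_const _)]
      refine MeasureTheory.integral_congr_ae (Filter.Eventually.of_forall fun u => ?_)
      simp only [map_sub, hLinv]
      abel
    rw [h1]
    refine (MeasureTheory.norm_integral_le_of_norm_le_const
      (C := c * ‖q.1 - q.2‖) (Filter.Eventually.of_forall fun u => ?_)).trans_eq (by simp)
    calc ‖L u (φ u⁻¹ q.1 - φ u⁻¹ q.2 - L u⁻¹ (q.1 - q.2))‖
        ≤ (|C| + 1) * (c / (|C| + 1) * ‖q.1 - q.2‖) :=
          (L u).le_of_opNorm_le_of_le (hC' u) (hq u⁻¹)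
      _ = c * ‖q.1 - q.2‖ := by field_simp
  · filter_upwards [hmul, hci] with y hy hcy v
    -- Equivariance is invariance of Haar measure under the substitution `u ↦ v⁻¹u`.
    have h1 := MeasureTheory.integral_mul_left_eq_self (μ := m)
      (fun u => L (v * u) (φ u⁻¹ y - y₀)) v⁻¹
    have h2 : ∀ u, L (v * (v⁻¹ * u)) (φ (v⁻¹ * u)⁻¹ y - y₀) = L u (φ u⁻¹ (φ v y) - y₀) := by
      intro u
      rw [mul_inv_cancel_left, mul_inv_rev, inv_inv, hy]
    simp only [h2] at h1
    rw [h1, ← ContinuousLinearMap.integral_comp_comm _ (hint _ hcy)]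
    simp only [hLmul, ContinuousLinearMap.comp_apply]

end Linearization

/-! ### Functions critical on the fixed points of a compact group -/

section FixedPoints
variable {E : Type*} [NormedAddCommGroup E] [NormedSpace ℝ E]
  {S : Type*} [Group S] [TopologicalSpace S] [ChartedSpace E S] [IsManifold 𝓘(ℝ, E) ω S]
  {F : Type*} [NormedAddCommGroup F] [NormedSpace ℝ F]
  {Z : Type*} [TopologicalSpace Z] [ChartedSpace F Z] [IsManifold 𝓘(ℝ, F) ω Z]
  [MulAction S Z]

variable (F) in
/-- The action of `g` in the chart at `x`. -/
def chartAction (x : Z) (g : S) (y : F) : F :=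
  extChartAt 𝓘(ℝ, F) x (g • (extChartAt 𝓘(ℝ, F) x).symm y)

theorem contMDiffAt_chartAction
    (hact : ContMDiff (𝓘(ℝ, E).prod 𝓘(ℝ, F)) 𝓘(ℝ, F) ω (fun q : S × Z => q.1 • q.2))
    {x : Z} {u : S} (hu : u • x = x) :
    ContMDiffAt (𝓘(ℝ, E).prod 𝓘(ℝ, F)) 𝓘(ℝ, F) ω
      (fun q : S × F => chartAction F x q.1 q.2) (u, extChartAt 𝓘(ℝ, F) x x) := by
  have h1 : ContMDiffAt 𝓘(ℝ, F) 𝓘(ℝ, F) ω (extChartAt 𝓘(ℝ, F) x).symm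
      (extChartAt 𝓘(ℝ, F) x x) :=
    (contMDiffOn_extChartAt_symm x).contMDiffAt (extChartAt_target_mem_nhds x)
  have h2 : ContMDiffAt (𝓘(ℝ, E).prod 𝓘(ℝ, F)) 𝓘(ℝ, F) ω
      (fun q : S × F => q.1 • (extChartAt 𝓘(ℝ, F) x).symm q.2)
      (u, extChartAt 𝓘(ℝ, F) x x) :=
    ContMDiffAt.comp (u, extChartAt 𝓘(ℝ, F) x x) (hact _) (contMDiffAt_fst.prodMk
      (ContMDiffAt.comp (u, extChartAt 𝓘(ℝ, F) x x) h1 contMDiffAt_snd))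
  have h3 : ContMDiffAt 𝓘(ℝ, F) 𝓘(ℝ, F) ω (extChartAt 𝓘(ℝ, F) x)
      (u • (extChartAt 𝓘(ℝ, F) x).symm (extChartAt 𝓘(ℝ, F) x x)) := by
    rw [extChartAt_to_inv, hu]
    exact contMDiffAt_extChartAt
  exact ContMDiffAt.comp (u, extChartAt 𝓘(ℝ, F) x x) h3 h2

theorem continuousAt_fderiv_chartAction
    (hact : ContMDiff (𝓘(ℝ, E).prod 𝓘(ℝ, F)) 𝓘(ℝ, F) ω (fun q : S × Z => q.1 • q.2))
    {x : Z} {u : S} (hu : u • x = x) :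
    ContinuousAt (fun q : S × F => fderiv ℝ (chartAction F x q.1) q.2)
      (u, extChartAt 𝓘(ℝ, F) x x) := by
  have h1 : ContMDiffAt ((𝓘(ℝ, E).prod 𝓘(ℝ, F)).prod 𝓘(ℝ, F)) 𝓘(ℝ, F) ω
      (Function.uncurry fun (q : S × F) (y : F) => chartAction F x q.1 y)
      ((u, extChartAt 𝓘(ℝ, F) x x), (u, extChartAt 𝓘(ℝ, F) x x).2) :=
    ContMDiffAt.comp (g := fun q : S × F => chartAction F x q.1 q.2)
      (f := fun q : (S × F) × F => (q.1.1, q.2))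
      ((u, extChartAt 𝓘(ℝ, F) x x), (u, extChartAt 𝓘(ℝ, F) x x).2)
      (contMDiffAt_chartAction hact hu)
      ((contMDiffAt_fst.comp _ contMDiffAt_fst).prodMk contMDiffAt_snd)
  have h2 := ContMDiffAt.mfderiv (m := 0) (fun (q : S × F) (y : F) => chartAction F x q.1 y)
    Prod.snd h1 contMDiffAt_snd le_top
  have h3 := inTangentCoordinates_model_space (I := 𝓘(ℝ, F)) (I' := 𝓘(ℝ, F))
    (fun q : S × F => q.2) (fun q : S × F => chartAction F x q.1 q.2)
    (fun q : S × F => fderiv ℝ (chartAction F x q.1) q.2) (u, extChartAt 𝓘(ℝ, F) x x)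
  simp only [mfderiv_eq_fderiv] at h2
  exact (h3 ▸ h2).continuousAt

theorem eventually_differentiableAt_chartAction
    (hact : ContMDiff (𝓘(ℝ, E).prod 𝓘(ℝ, F)) 𝓘(ℝ, F) ω (fun q : S × Z => q.1 • q.2))
    {x : Z} {u : S} (hu : u • x = x) :
    ∀ᶠ q : S × F in 𝓝 (u, extChartAt 𝓘(ℝ, F) x x),
      DifferentiableAt ℝ (chartAction F x q.1) q.2 := by
  filter_upwards [(contMDiffAt_iff_contMDiffAt_nhds (n := 1) (by simp)).1
    ((contMDiffAt_chartAction hact hu).of_le le_top)] with q hq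
  have h1 : ContMDiffAt 𝓘(ℝ, F) 𝓘(ℝ, F) 1 (fun y => chartAction F x q.1 y) q.2 :=
    ContMDiffAt.comp (g := fun q : S × F => chartAction F x q.1 q.2) (f := fun y : F => (q.1, y))
      q.2 hq (contMDiffAt_const.prodMk contMDiffAt_id)
  exact h1.contDiffAt.differentiableAt one_ne_zero

/-- Elements of a compact set fixing `x` are equi-strictly-differentiable at `x`. -/
theorem eventually_norm_chartAction_sub_le
    (hact : ContMDiff (𝓘(ℝ, E).prod 𝓘(ℝ, F)) 𝓘(ℝ, F) ω (fun q : S × Z => q.1 • q.2))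
    {x : Z} {T : Set S} (hT : IsCompact T) (hx : ∀ u ∈ T, u • x = x) {ε : ℝ} (hε : 0 < ε) :
    ∀ᶠ q : F × F in 𝓝 (extChartAt 𝓘(ℝ, F) x x, extChartAt 𝓘(ℝ, F) x x), ∀ u ∈ T,
      ‖chartAction F x u q.1 - chartAction F x u q.2
        - fderiv ℝ (chartAction F x u) (extChartAt 𝓘(ℝ, F) x x) (q.1 - q.2)‖
        ≤ ε * ‖q.1 - q.2‖ := by
  set y₀ := extChartAt 𝓘(ℝ, F) x x
  have h1 : ∀ᶠ y in 𝓝 y₀, ∀ u ∈ T, DifferentiableAt ℝ (chartAction F x u) y ∧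
      ‖fderiv ℝ (chartAction F x u) y - fderiv ℝ (chartAction F x u) y₀‖ ≤ ε := by
    refine hT.eventually_forall_of_forall_eventually
      (P := fun y u => DifferentiableAt ℝ (chartAction F x u) y ∧
        ‖fderiv ℝ (chartAction F x u) y - fderiv ℝ (chartAction F x u) y₀‖ ≤ ε) fun u hu => ?_
    have hswap : Filter.Tendsto (fun q : F × S => (q.2, q.1)) (𝓝 (y₀, u)) (𝓝 (u, y₀)) :=
      continuous_swap.tendsto (y₀, u)
    have hbase : Filter.Tendsto (fun q : F × S => (q.2, y₀)) (𝓝 (y₀, u)) (𝓝 (u, y₀)) :=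
      (continuous_snd.prodMk continuous_const).tendsto (y₀, u)
    have hc := continuousAt_fderiv_chartAction hact (hx u hu)
    have hlim := (Filter.Tendsto.sub (hc.tendsto.comp hswap) (hc.tendsto.comp hbase)).norm
    rw [sub_self, norm_zero] at hlim
    exact (hswap.eventually (eventually_differentiableAt_chartAction hact (hx u hu))).and
      (hlim.eventually_le_const hε)
  obtain ⟨r, hr, hball⟩ := Metric.eventually_nhds_iff_ball.1 h1
  have h2 : ∀ᶠ q : F × F in 𝓝 (y₀, y₀), q.1 ∈ Metric.ball y₀ r ∧ q.2 ∈ Metric.ball y₀ r := by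
    rw [nhds_prod_eq]
    have hb : ∀ᶠ y in 𝓝 y₀, y ∈ Metric.ball y₀ r := Metric.ball_mem_nhds y₀ hr
    exact hb.prod_mk hb
  filter_upwards [h2] with q hq u hu
  exact (convex_ball y₀ r).norm_image_sub_le_of_norm_hasFDerivWithin_le'
    (fun y hy => ((hball y hy u hu).1.hasFDerivAt).hasFDerivWithinAt)
    (fun y hy => (hball y hy u hu).2) hq.2 hq.1

/-- A function on `Z` that is critical at all fixed points of a compact group is locally constant
on the set of fixed points. -/
theorem eventually_eq_of_critical_on_fixedPoints [FiniteDimensional ℝ F] [IsTopologicalGroup S]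
    (hact : ContMDiff (𝓘(ℝ, E).prod 𝓘(ℝ, F)) 𝓘(ℝ, F) ω (fun q : S × Z => q.1 • q.2))
    {T : Subgroup S} (hT : IsCompact (T : Set S)) {x : Z} (hx : ∀ u ∈ T, u • x = x) {f : Z → ℝ}
    (hf : ∀ z, (∀ u ∈ T, u • z = z) →
      HasMFDerivAt 𝓘(ℝ, F) 𝓘(ℝ, ℝ) f z (0 : F →L[ℝ] ℝ)) :
    ∀ᶠ z in 𝓝 x, (∀ u ∈ T, u • z = z) → f z = f x := by
  have : CompactSpace T := isCompact_iff_compactSpace.1 hT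
  set e := extChartAt 𝓘(ℝ, F) x with he
  set y₀ := e x with hy₀
  have hex : e.symm y₀ = x := extChartAt_to_inv x
  have hsmul : Continuous fun q : S × Z => q.1 • q.2 := hact.continuous
  have hsymm : ContinuousAt e.symm y₀ := continuousAt_extChartAt_symm x
  have htarget : ∀ᶠ y in 𝓝 y₀, y ∈ e.target := extChartAt_target_mem_nhds x
  have hopen : IsOpen e.source := isOpen_extChartAt_source x
  have hxs : x ∈ e.source := mem_extChartAt_source x
  -- Compactness of the group gives one neighbourhood that all its elements keep inside the chart,
  -- so the action law holds there in coordinates.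
  have hstay : ∀ᶠ y in 𝓝 y₀, ∀ u ∈ (T : Set S), u • e.symm y ∈ e.source := by
    refine hT.eventually_forall_of_forall_eventually
      (P := fun y u => u • e.symm y ∈ e.source) fun u hu => ?_
    have h1 : ContinuousAt (fun q : F × S => q.2 • e.symm q.1) (y₀, u) :=
      ContinuousAt.comp (g := fun q : S × Z => q.1 • q.2) (f := fun q : F × S => (q.2, e.symm q.1))
        hsmul.continuousAt (continuousAt_snd.prodMk
          (ContinuousAt.comp (x := (y₀, u)) (f := Prod.fst) hsymm continuousAt_fst))
    refine h1.eventually (hopen.mem_nhds ?_)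
    simp only [hex, hx u hu, hxs]
  have hφdef : ∀ (u : S) (y : F), chartAction F x u y = e (u • e.symm y) := fun _ _ => rfl
  have hmul : ∀ᶠ y in 𝓝 y₀, ∀ u v : T, chartAction F x ((u * v : T) : S) y =
      chartAction F x (u : S) (chartAction F x (v : S) y) := by
    filter_upwards [hstay] with y hy u v
    rw [hφdef, hφdef, hφdef, e.left_inv (hy v v.2), Subgroup.coe_mul, mul_smul]
  have hfix : ∀ u : T, chartAction F x (u : S) y₀ = y₀ := fun u => by
    rw [hφdef, hex, hx u u.2]
  have hdiff : ∀ u : T, DifferentiableAt ℝ (chartAction F x (u : S)) y₀ := fun u =>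
    (eventually_differentiableAt_chartAction hact (hx u u.2)).self_of_nhds
  have htube : ∀ s ∈ 𝓝 y₀, ∀ᶠ y in 𝓝 y₀, ∀ u : T, chartAction F x (u : S) y ∈ s := by
    intro s hs
    have := hT.eventually_forall_of_forall_eventually (x₀ := y₀)
      (P := fun y u => chartAction F x u y ∈ s) fun u hu => by
        have h1 : ContinuousAt (fun q : F × S => chartAction F x q.2 q.1) (y₀, u) :=
          ContinuousAt.comp (g := fun q : S × F => chartAction F x q.1 q.2) (f := Prod.swap)
            (x := (y₀, u)) (contMDiffAt_chartAction hact (hx u hu)).continuousAt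
            continuous_swap.continuousAt
        refine h1.eventually ?_
        have h2 := hfix ⟨u, hu⟩
        simp only at h2
        simp only [h2]
        exact hs
    exact this.mono fun y hy u => hy u u.2
  -- The linear model is the isotropy representation at `x`, written in the chart.
  obtain ⟨ψ, hψ, hψ₀, heq⟩ := exists_linearization
    (φ := fun (u : T) => chartAction F x (u : S)) (y₀ := y₀)
    (L := fun u : T => fderiv ℝ (chartAction F x (u : S)) y₀) hfix hmul
    (by
      filter_upwards [hstay] with y hy
      exact (continuousOn_extChartAt x).comp_continuous
        (hsmul.comp (continuous_subtype_val.prodMk continuous_const)) fun u => hy u u.2)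
    (continuous_iff_continuousAt.2 fun u =>
      ContinuousAt.comp (g := fun q : S × F => fderiv ℝ (chartAction F x q.1) q.2)
        (f := fun u : T => ((u : S), y₀)) (continuousAt_fderiv_chartAction hact (hx u u.2))
        (continuous_subtype_val.prodMk continuous_const).continuousAt)
    (fun u v => by
      have h1 : chartAction F x ((u * v : T) : S) =ᶠ[𝓝 y₀]
          chartAction F x (u : S) ∘ chartAction F x (v : S) := hmul.mono fun y hy => hy u v
      have h2 : DifferentiableAt ℝ (chartAction F x (u : S)) (chartAction F x (v : S) y₀) := by
        rw [hfix v]; exact hdiff u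
      rw [h1.fderiv_eq, fderiv_comp y₀ h2 (hdiff v), hfix v])
    (by
      have h1 : chartAction F x ((1 : T) : S) =ᶠ[𝓝 y₀] id := by
        filter_upwards [htarget] with y hy
        rw [hφdef, Subgroup.coe_one, one_smul, e.right_inv hy, id]
      rw [h1.fderiv_eq, fderiv_id])
    (fun ε hε => (eventually_norm_chartAction_sub_le hact hT hx hε).mono fun q hq u => hq u u.2)
  have hiff : ∀ y, (y ∈ e.target) → (∀ u ∈ (T : Set S), u • e.symm y ∈ e.source) →
      (∀ u : T, chartAction F x (u : S) y = y) → ∀ u ∈ T, u • e.symm y = e.symm y := by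
    intro y hy hys hfy u hu
    have := hfy ⟨u, hu⟩
    rw [hφdef] at this
    calc u • e.symm y = e.symm (e (u • e.symm y)) := (e.left_inv (hys u hu)).symm
      _ = e.symm y := by rw [this]
  have hcrit : ∀ᶠ y in 𝓝 y₀, (∀ u : T, chartAction F x (u : S) y = y) →
      HasFDerivAt (fun y => f (e.symm y)) (0 : F →L[ℝ] ℝ) y := by
    filter_upwards [hstay, htarget] with y hys hyt hfy
    have h1 := hf _ (hiff y hyt hys hfy)
    have h2 : MDifferentiableAt 𝓘(ℝ, F) 𝓘(ℝ, F) e.symm y :=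
      ((contMDiffOn_extChartAt_symm (n := ω) x).contMDiffAt
        ((isOpen_extChartAt_target x).mem_nhds hyt)).mdifferentiableAt (by simp)
    have h3 := HasMFDerivAt.comp y h1 h2.hasMFDerivAt
    have key : (0 : F →L[ℝ] ℝ) ∘L (mfderiv 𝓘(ℝ, F) 𝓘(ℝ, F) e.symm y : F →L[ℝ] F) = 0 :=
      ContinuousLinearMap.zero_comp _
    exact hasMFDerivAt_iff_hasFDerivAt.1 (h3.congr_mfderiv key)
  have hmain := eventually_eq_of_critical_of_linearization hψ hψ₀ heq htube hcrit
  have he' : ContinuousAt e x := continuousAt_extChartAt x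
  filter_upwards [he'.eventually hmain, hopen.mem_nhds hxs] with z hz hzs hzfix
  rw [e.left_inv hzs] at hz
  have h1 := hz fun u => by rw [hφdef, e.left_inv hzs, hzfix u u.2]
  rw [h1, hex]

end FixedPoints

/-! ### Uniqueness of the orthogonal projection -/

section Projection
variable {E : Type*} [AddCommGroup E] [Module ℝ E]

theorem orthProj_eq_of_mem (B : LinearMap.BilinForm ℝ E) (p : Submodule ℝ E)
    [FiniteDimensional ℝ p] (hB : ∀ α ∈ p, α ≠ 0 → 0 < B α α) {v w : E} (hw : w ∈ p)
    (h : ∀ α ∈ p, B w α = B v α) : orthProj B p v = w := by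
  obtain ⟨h1, h2⟩ := orthProj_spec B p hB v
  by_contra hne
  have h3 := hB _ (p.sub_mem h1 hw) (sub_ne_zero.2 hne)
  rw [LinearMap.map_sub₂, h2 _ (p.sub_mem h1 hw), h _ (p.sub_mem h1 hw), sub_self] at h3
  exact lt_irrefl _ h3

end Projection

/-! ### The sets of maxima and the groups acting on them -/

section Main
variable {E : Type*} [NormedAddCommGroup E] [NormedSpace ℂ E] [FiniteDimensional ℂ E]
  {S : Type*} [Group S] [TopologicalSpace S] [ChartedSpace E S] [LieGroup 𝓘(ℂ, E) ω S] [T2Space S]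
  {F : Type*} [NormedAddCommGroup F] [NormedSpace ℂ F]
  {Z : Type*} [TopologicalSpace Z] [ChartedSpace F Z] [IsManifold 𝓘(ℂ, F) ω Z] [T2Space Z]
  [MulAction S Z]
  {Θ : S ≃* S} {B : LinearMap.BilinForm ℝ E} {h : RiemMetric F Z} {μ : Z → E}
  {G : Subgroup S} {p : Submodule ℝ E} {X : Set Z} {σ β : E}

theorem mem_centralizerIn_iff {g : S} : g ∈ centralizerIn G β ↔ g ∈ G ∧ Ad g β = β := by
  rw [centralizerIn, Subgroup.mem_inf, Subgroup.mem_centralizer_iff, Ad_eq_self_iff]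
  refine and_congr_right fun _ => ⟨fun H t => (H _ ⟨t, rfl⟩).symm, ?_⟩
  rintro H _ ⟨t, rfl⟩
  exact (H t).symm

theorem IsCompatible.lieExp_mem (hG : IsCompatible Θ G p) {α : E} (hα : α ∈ p) :
    lieExp S α ∈ G :=
  (hG.mem_iff _).2 ⟨1, one_mem _, α, hα, (one_mul _).symm⟩

theorem IsCompatible.lieExp_smul_mem (hG : IsCompatible Θ G p) {α : E} (hα : α ∈ p) (t : ℝ) :
    lieExp S (t • α) ∈ G := hG.lieExp_mem (p.smul_mem t hα)

theorem IsCompatible.map_mem (hΘ : IsCartanInvolution E Θ) (hG : IsCompatible Θ G p) {g : S}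
    (hg : g ∈ G) : Θ g ∈ G := by
  obtain ⟨k, hk, α, hα, rfl⟩ := (hG.mem_iff g).1 hg
  rw [map_mul, hΘ.map_lieExp_of_mem (hG.le_iu hα), mem_fixedSubgroup_iff.1 hk.1]
  exact mul_mem hk.2 (inv_mem (hG.lieExp_mem hα))

/-- The centralizer `G^β` inherits the Cartan decomposition. -/
theorem IsCompatible.exists_factors (hΘ : IsCartanInvolution E Θ) (hG : IsCompatible Θ G p)
    (hβ : β ∈ p) {g : S} (hg : g ∈ centralizerIn G β) :
    ∃ k ∈ stabK Θ G β, ∃ α ∈ pCentralizer G p β, g = k * lieExp S α := by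
  obtain ⟨hgG, hgβ⟩ := mem_centralizerIn_iff.1 hg
  obtain ⟨k, hk, α, hα, rfl⟩ := (hG.mem_iff g).1 hgG
  obtain ⟨h1, h2⟩ := hΘ.Ad_factors_eq_self (hG.le_iu hβ) hk.1 (hG.le_iu hα) hgβ
  exact ⟨k, ⟨hk, h1⟩, α, ⟨hα, fun t => mem_centralizerIn_iff.2 ⟨hG.lieExp_smul_mem hα t, h2 t⟩⟩,
    rfl⟩

theorem isCompact_stabK (hΘ : IsCartanInvolution E Θ) (hG : IsCompatible Θ G p) (β : E) :
    IsCompact (stabK Θ G β) := by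
  have h1 : IsClosed {k : S | Ad k β = β} :=
    isClosed_eq ((ContinuousLinearMap.apply ℂ E β).continuous.comp continuous_Ad)
      continuous_const
  have h2 : stabK Θ G β = (fixedSubgroup Θ : Set S) ∩ ((G : Set S) ∩ {k : S | Ad k β = β}) := by
    ext k
    exact and_assoc
  rw [h2]
  exact hΘ.compact.inter_right (hG.closed.inter h1)

theorem restrictedMomentum_mem (hB : IsInvariantInnerProduct Θ B) (hG : IsCompatible Θ G p)
    (z : Z) : restrictedMomentum B p μ z ∈ p := by
  have := FiniteDimensional.complexToReal E
  exact (orthProj_spec B p (fun α hα => hB.pos α (hG.le_iu hα)) (μ z)).1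

theorem restrictedMomentum_apply (hB : IsInvariantInnerProduct Θ B) (hG : IsCompatible Θ G p)
    (hβ : β ∈ p) (z : Z) : B (restrictedMomentum B p μ z) β = B (μ z) β := by
  have := FiniteDimensional.complexToReal E
  exact (orthProj_spec B p (fun α hα => hB.pos α (hG.le_iu hα)) (μ z)).2 β hβ

/-- `Ad k` preserves both the inner product and `𝔭`, so it commutes with the orthogonal projection
to `𝔭`. -/
theorem restrictedMomentum_smul (hB : IsInvariantInnerProduct Θ B)
    (hG : IsCompatible Θ G p) (hμ : IsMomentumMap Θ B h μ) {k : S}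
    (hk : k ∈ fixedSubgroup Θ ⊓ G) (z : Z) :
    restrictedMomentum B p μ (k • z) = Ad k (restrictedMomentum B p μ z) := by
  have := FiniteDimensional.complexToReal E
  refine orthProj_eq_of_mem B p (fun α hα => hB.pos α (hG.le_iu hα))
    (hG.ad_stable k hk _ (restrictedMomentum_mem hB hG z)) fun α hα => ?_
  have hα' := hG.ad_stable k⁻¹ (inv_mem hk) α hα
  rw [hμ.equivariant k hk.1, ← Ad_apply_Ad_inv k α,
    hB.invariant k hk.1 _ (hG.le_iu (restrictedMomentum_mem hB hG z)) _ (hG.le_iu hα'),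
    hB.invariant k hk.1 _ (hμ.mem_iu z) _ (hG.le_iu hα'), restrictedMomentum_apply hB hG hα']

theorem mem_maxSet_iff (hB : IsInvariantInnerProduct Θ B) (hG : IsCompatible Θ G p)
    (hβ : β ∈ p) {x : Z} :
    x ∈ maxSet B p μ X β ↔ x ∈ X ∧ ∀ y ∈ X, B (μ y) β ≤ B (μ x) β := by
  simp only [maxSet, Set.mem_ofPred_eq, restrictedMomentum_apply hB hG hβ]

/-- `μ^β` is locally constant on the zero set of `β_Z`. -/
theorem IsMomentumMap.eventually_component_eq [FiniteDimensional ℂ F]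
    (hμ : IsMomentumMap Θ B h μ) (hΘ : IsCartanInvolution E Θ)
    (hact : ContMDiff (𝓘(ℂ, E).prod 𝓘(ℂ, F)) 𝓘(ℂ, F) ω (fun q : S × Z => q.1 • q.2))
    (hβ : β ∈ iu Θ) {x : Z} (hx : fundVec S F β x = 0) :
    ∀ᶠ z in 𝓝 x, fundVec S F β z = 0 → B (μ z) β = B (μ x) β := by
  have := topologicalGroup_of_lieGroup 𝓘(ℂ, E) ω (G := S)
  have := FiniteDimensional.complexToReal F
  have hsmul : Continuous fun q : S × Z => q.1 • q.2 := hact.continuous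
  -- Taking everything in `U` that fixes the zeros of `β_Z` gives a closed, hence compact, group.
  -- Its fixed points are no more than those zeros because it contains all `exp(tiβ)` and `(iβ)_Z =
  -- iβ_Z`.
  let T : Subgroup S := fixedSubgroup Θ ⊓ fixingSubgroup S {z : Z | fundVec S F β z = 0}
  have hTmem : ∀ u, u ∈ T ↔ u ∈ fixedSubgroup Θ ∧ ∀ z : Z, fundVec S F β z = 0 → u • z = z :=
    fun u => and_congr_right fun _ => mem_fixingSubgroup_iff S
  have hTc : IsCompact (T : Set S) := by
    have h1 : (T : Set S) = (fixedSubgroup Θ : Set S) ∩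
        ⋂ z : {z : Z | fundVec S F β z = 0}, {u : S | u • (z : Z) = z} := by
      ext u
      simp only [SetLike.mem_coe, hTmem, Set.mem_inter_iff, Set.mem_iInter, Set.mem_ofPred_eq,
        Subtype.forall]
    rw [h1]
    exact hΘ.compact.inter_right (isClosed_iInter fun z => isClosed_eq
      (hsmul.comp (continuous_id.prodMk continuous_const)) continuous_const)
  have hfixed : ∀ z : Z, (∀ u ∈ T, u • z = z) ↔ fundVec S F β z = 0 := by
    intro z
    refine ⟨fun H => ?_, fun hz u hu => ((hTmem u).1 hu).2 z hz⟩
    have h1 : fundVec S F (Complex.I • β) z = 0 :=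
      fundVec_eq_zero_of_fixed hact fun t => H _ ((hTmem _).2
        ⟨hΘ.lieExp_smul_I_smul_mem hβ t, fun w hw => lieExp_smul_eq_self hact
          (by rw [fundVec_smul, hw, smul_zero]) t⟩)
    rw [fundVec_smul] at h1
    exact (smul_eq_zero.1 h1).resolve_left Complex.I_ne_zero
  have hmain := eventually_eq_of_critical_on_fixedPoints (contMDiff_prod_real_of_complex hact)
    hTc (x := x) ((hfixed x).2 hx) (f := fun z => B (μ z) β) fun z hz => by
      have h1 := ((hμ.contMDiff_component β).mdifferentiable (by simp) z).hasMFDerivAt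
      refine h1.congr_mfderiv ?_
      have h2 : (diffReal (fun z' => B (μ z') β) z : F →L[ℝ] ℝ) = 0 := by
        ext v
        rw [hμ.gradient β hβ, (hfixed z).1 hz, h.ip_zero_left]
        rfl
      exact h2
  exact hmain.mono fun z hz hz0 => hz ((hfixed z).2 hz0)

/-- The flow of `β` stays in `X` and cannot increase `μ^β` beyond its maximum. -/
theorem maxSet_subset_zeroSet (hB : IsInvariantInnerProduct Θ B) (hG : IsCompatible Θ G p)
    (hμ : IsMomentumMap Θ B h μ)
    (hact : ContMDiff (𝓘(ℂ, E).prod 𝓘(ℂ, F)) 𝓘(ℂ, F) ω (fun q : S × Z => q.1 • q.2))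
    (hXG : ∀ g ∈ G, ∀ x ∈ X, g • x ∈ X) (hβ : β ∈ p) :
    maxSet B p μ X β ⊆ zeroSet S F X β := by
  intro x hx
  obtain ⟨hxX, hmax⟩ := (mem_maxSet_iff hB hG hβ).1 hx
  exact ⟨hxX, hμ.fundVec_eq_zero hact (hG.le_iu hβ) one_pos
    (hmax _ (hXG _ (hG.lieExp_smul_mem hβ 1) x hxX))⟩

theorem isClopen_maxSet [FiniteDimensional ℂ F] (hΘ : IsCartanInvolution E Θ)
    (hB : IsInvariantInnerProduct Θ B) (hG : IsCompatible Θ G p) (hμ : IsMomentumMap Θ B h μ)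
    (hact : ContMDiff (𝓘(ℂ, E).prod 𝓘(ℂ, F)) 𝓘(ℂ, F) ω (fun q : S × Z => q.1 • q.2))
    (hβ : β ∈ p) :
    IsClopen ((↑) ⁻¹' maxSet B p μ X β : Set (zeroSet S F X β)) := by
  have hc := (hμ.continuous_component β).comp (continuous_subtype_val (p := (· ∈ zeroSet S F X β)))
  constructor
  · have h1 : ((↑) ⁻¹' maxSet B p μ X β : Set (zeroSet S F X β)) =
        ⋂ y : X, {x : zeroSet S F X β | B (μ y) β ≤ B (μ x) β} := by
      ext x
      simp only [Set.mem_preimage, mem_maxSet_iff hB hG hβ, x.2.1, true_and, Set.mem_iInter,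
        Set.mem_ofPred_eq, Subtype.forall]
    rw [h1]
    exact isClosed_iInter fun y => isClosed_le continuous_const hc
  · rw [isOpen_iff_mem_nhds]
    intro x hx
    have h1 := continuous_subtype_val.continuousAt.eventually
      (hμ.eventually_component_eq hΘ hact (hG.le_iu hβ) x.2.2)
    filter_upwards [h1] with y hy
    have hx' := (mem_maxSet_iff hB hG hβ).1 hx
    refine (mem_maxSet_iff hB hG hβ).2 ⟨y.2.1, fun w hw => ?_⟩
    rw [hy y.2.2]
    exact hx'.2 w hw

/-- `μ^β` is invariant under `G^β` on the zero set of `β_Z`. -/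
theorem component_smul_eq (hΘ : IsCartanInvolution E Θ) (hB : IsInvariantInnerProduct Θ B)
    (hG : IsCompatible Θ G p) (hμ : IsMomentumMap Θ B h μ)
    (hact : ContMDiff (𝓘(ℂ, E).prod 𝓘(ℂ, F)) 𝓘(ℂ, F) ω (fun q : S × Z => q.1 • q.2))
    (hβ : β ∈ p) {g : S} (hg : g ∈ centralizerIn G β) {x : Z} (hx : fundVec S F β x = 0) :
    B (μ (g • x)) β = B (μ x) β := by
  obtain ⟨k, hk, α, hα, rfl⟩ := hG.exists_factors hΘ hβ hg
  -- Since `exp(tα)` commutes with the flow of `β`, the curve `exp(tα)x` stays among the zeros of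
  -- `β_Z`, where `(β_Z, α_Z) = 0`.
  have hzero : ∀ t : ℝ, fundVec S F β (lieExp S (t • α) • x) = 0 := fun t => by
    refine fundVec_eq_zero_of_fixed hact fun s => ?_
    have h1 := Ad_eq_self_iff.1 (mem_centralizerIn_iff.1 (hα.2 t)).2 s
    rw [← mul_smul, ← h1, mul_smul, lieExp_smul_eq_self hact hx]
  have hd : ∀ t : ℝ, HasDerivAt (fun t : ℝ => B (μ (lieExp S (t • α) • x)) β) 0 t := fun t => by
    have := hμ.hasDerivAt hact (hG.le_iu hβ) α x t
    rwa [hzero t, h.ip_zero_left] at this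
  have hc := is_const_of_deriv_eq_zero (fun t => (hd t).differentiableAt)
    (fun t => (hd t).deriv) 1 0
  simp only [one_smul, zero_smul, lieExp_zero] at hc
  rw [← hc, mul_smul, hμ.equivariant k hk.1.1]
  -- One `β` is replaced by `Ad k β` so that invariance of the inner product applies.
  nth_rewrite 1 [← hk.2]
  exact hB.invariant k hk.1.1 _ (hμ.mem_iu _) _ (hG.le_iu hβ)

theorem smul_mem_maxSet (hΘ : IsCartanInvolution E Θ) (hB : IsInvariantInnerProduct Θ B)
    (hG : IsCompatible Θ G p) (hμ : IsMomentumMap Θ B h μ)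
    (hact : ContMDiff (𝓘(ℂ, E).prod 𝓘(ℂ, F)) 𝓘(ℂ, F) ω (fun q : S × Z => q.1 • q.2))
    (hXG : ∀ g ∈ G, ∀ x ∈ X, g • x ∈ X) (hβ : β ∈ p) {g : S} (hg : g ∈ centralizerIn G β) {x : Z}
    (hx : x ∈ maxSet B p μ X β) : g • x ∈ maxSet B p μ X β := by
  have hx0 := (maxSet_subset_zeroSet hB hG hμ hact hXG hβ hx).2
  rw [mem_maxSet_iff hB hG hβ] at hx ⊢
  rw [component_smul_eq hΘ hB hG hμ hact hβ hg hx0]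
  exact ⟨hXG g (mem_centralizerIn_iff.1 hg).1 x hx.1, hx.2⟩

/-- The extreme point is a value `μ_𝔭(x₀)`, so the maximum is at least `⟨σ, β⟩`; exposedness says
that no other point of the hull reaches this level. -/
theorem fiber_eq_maxSet (hB : IsInvariantInnerProduct Θ B) (hG : IsCompatible Θ G p)
    (hσ : σ ∈ Set.extremePoints ℝ (momentumHull B p μ X))
    (hβ : β ∈ exposingCone B p (momentumHull B p μ X) σ) :
    {x | x ∈ X ∧ restrictedMomentum B p μ x = σ} = maxSet B p μ X β := by
  obtain ⟨x₀, hx₀, rfl⟩ := extremePoints_convexHull_subset hσ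
  obtain ⟨hβp, hβσ⟩ := hβ
  have hsymm : ∀ z, B (restrictedMomentum B p μ z) β = B β (restrictedMomentum B p μ z) :=
    fun z => hB.symm _ (hG.le_iu (restrictedMomentum_mem hB hG z)) _ (hG.le_iu hβp)
  have key : ∀ y ∈ X, B β (restrictedMomentum B p μ x₀) ≤ B β (restrictedMomentum B p μ y) →
      restrictedMomentum B p μ y = restrictedMomentum B p μ x₀ := by
    intro y hy hle
    have : restrictedMomentum B p μ y ∈ ({restrictedMomentum B p μ x₀} : Set E) := by
      rw [← hβσ]
      exact ⟨subset_convexHull ℝ _ ⟨y, hy, rfl⟩, restrictedMomentum_mem hB hG y, hle⟩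
    exact this
  ext x
  constructor
  · rintro ⟨hx, hxσ⟩
    refine ⟨hx, fun y hy => ?_⟩
    rw [hsymm, hsymm, hxσ]
    by_contra! hlt
    rw [key y hy hlt.le] at hlt
    exact lt_irrefl _ hlt
  · rintro ⟨hx, hmax⟩
    refine ⟨hx, key x hx ?_⟩
    rw [← hsymm, ← hsymm]
    exact hmax x₀ hx₀

/-- Both `x` and `exp(α)x` lie in the fibre over `σ`, so `μ^α` agrees at the two ends of a piece of
its own gradient flow. -/
theorem fundVec_eq_zero_of_mem_pCentralizer (hΘ : IsCartanInvolution E Θ)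
    (hB : IsInvariantInnerProduct Θ B) (hG : IsCompatible Θ G p) (hμ : IsMomentumMap Θ B h μ)
    (hact : ContMDiff (𝓘(ℂ, E).prod 𝓘(ℂ, F)) 𝓘(ℂ, F) ω (fun q : S × Z => q.1 • q.2))
    (hXG : ∀ g ∈ G, ∀ x ∈ X, g • x ∈ X)
    (hσ : σ ∈ Set.extremePoints ℝ (momentumHull B p μ X))
    (hβ : β ∈ exposingCone B p (momentumHull B p μ X) σ) {x : Z} (hx : x ∈ maxSet B p μ X β)
    {α : E} (hα : α ∈ pCentralizer G p β) : fundVec S F α x = 0 := by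
  have h1 := smul_mem_maxSet hΘ hB hG hμ hact hXG hβ.1 (hα.2 1) hx
  rw [← fiber_eq_maxSet hB hG hσ hβ] at h1 hx
  refine hμ.fundVec_eq_zero hact (hG.le_iu hα.1) one_pos ?_
  rw [← restrictedMomentum_apply hB hG hα.1 (lieExp S ((1 : ℝ) • α) • x),
    ← restrictedMomentum_apply hB hG hα.1 x, h1.2, hx.2]

/-- In `G^β = K^β exp(𝔭^β)` the second factor fixes `x`, so the orbit is that of the compact group
`K^β`. -/
theorem isCompact_orbit_centralizerIn (hΘ : IsCartanInvolution E Θ)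
    (hB : IsInvariantInnerProduct Θ B) (hG : IsCompatible Θ G p) (hμ : IsMomentumMap Θ B h μ)
    (hact : ContMDiff (𝓘(ℂ, E).prod 𝓘(ℂ, F)) 𝓘(ℂ, F) ω (fun q : S × Z => q.1 • q.2))
    (hXG : ∀ g ∈ G, ∀ x ∈ X, g • x ∈ X)
    (hσ : σ ∈ Set.extremePoints ℝ (momentumHull B p μ X))
    (hβ : β ∈ exposingCone B p (momentumHull B p μ X) σ) {x : Z} (hx : x ∈ maxSet B p μ X β) :
    IsCompact (MulAction.orbit (centralizerIn G β) x) := by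
  have h1 : MulAction.orbit (centralizerIn G β) x = (fun k : S => k • x) '' stabK Θ G β := by
    ext y
    constructor
    · rintro ⟨⟨g, hg⟩, rfl⟩
      obtain ⟨k, hk, α, hα, rfl⟩ := hG.exists_factors hΘ hβ.1 hg
      refine ⟨k, hk, ?_⟩
      have h2 := lieExp_smul_eq_self hact
        (fundVec_eq_zero_of_mem_pCentralizer hΘ hB hG hμ hact hXG hσ hβ hx hα) 1
      rw [one_smul] at h2
      change k • x = (k * lieExp S α) • x
      rw [mul_smul, h2]
    · rintro ⟨k, hk, rfl⟩
      exact ⟨⟨k, mem_centralizerIn_iff.2 ⟨hk.1.2, hk.2⟩⟩, rfl⟩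
  rw [h1]
  have hsmul : Continuous fun q : S × Z => q.1 • q.2 := hact.continuous
  exact (isCompact_stabK hΘ hG β).image (hsmul.comp (continuous_id.prodMk continuous_const))

/-- Elements of `R^{β+}` fix the points of `X^β_max`. -/
theorem smul_eq_self_of_mem_Rplus
    (hB : IsInvariantInnerProduct Θ B) (hG : IsCompatible Θ G p) (hμ : IsMomentumMap Θ B h μ)
    (hact : ContMDiff (𝓘(ℂ, E).prod 𝓘(ℂ, F)) 𝓘(ℂ, F) ω (fun q : S × Z => q.1 • q.2))
    (hXG : ∀ g ∈ G, ∀ x ∈ X, g • x ∈ X) (hβ : β ∈ p) {x : Z} (hx : x ∈ maxSet B p μ X β)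
    {g : S} (hg : g ∈ Rplus G β) : g • x = x := by
  have hsmul : Continuous fun q : S × Z => q.1 • q.2 := hact.continuous
  have hx0 := (maxSet_subset_zeroSet hB hG hμ hact hXG hβ hx).2
  have hlim : Filter.Tendsto (fun t : ℝ => lieExp S (t • β) • g • x) Filter.atBot (𝓝 x) := by
    have h1 : ∀ t : ℝ, lieExp S (t • β) • g • x =
        (lieExp S (t • β) * g * lieExp S (-(t • β))) • x := fun t => by
      rw [← neg_smul, mul_smul, mul_smul, lieExp_smul_eq_self hact hx0]
    simp only [h1]
    have h2 : Continuous fun k : S => k • x := hsmul.comp (continuous_id.prodMk continuous_const)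
    have h3 := (h2.tendsto 1).comp hg.2
    rwa [one_smul] at h3
  have hmaxx := (mem_maxSet_iff hB hG hβ).1 hx
  -- `μ^β` along `exp(tβ)gx` at times `t ≤ 0` is at most its value at `0` and tends to `μ^β(x)` as
  -- `t → -∞`.
  have hle : B (μ x) β ≤ B (μ (g • x)) β := by
    refine le_of_tendsto (((hμ.continuous_component β).tendsto x).comp hlim) ?_
    filter_upwards [Filter.eventually_le_atBot (0 : ℝ)] with t ht
    have := hμ.monotone hact (hG.le_iu hβ) (g • x) ht
    simpa [lieExp_zero] using this
  have hgx : g • x ∈ maxSet B p μ X β := (mem_maxSet_iff hB hG hβ).2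
    ⟨hXG g hg.1 x hmaxx.1, fun y hy => (hmaxx.2 y hy).trans hle⟩
  have hgx0 := (maxSet_subset_zeroSet hB hG hμ hact hXG hβ hgx).2
  simp only [lieExp_smul_eq_self hact hgx0] at hlim
  exact tendsto_nhds_unique tendsto_const_nhds hlim

/-- One inclusion is the fixedness of `β`. For the other, `K^β ⊆ G^β` preserves `X^β_max`, the fibre
over `σ`, so equivariance makes it fix `σ`. -/
theorem stabK_eq (hΘ : IsCartanInvolution E Θ)
    (hB : IsInvariantInnerProduct Θ B) (hG : IsCompatible Θ G p) (hμ : IsMomentumMap Θ B h μ)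
    (hact : ContMDiff (𝓘(ℂ, E).prod 𝓘(ℂ, F)) 𝓘(ℂ, F) ω (fun q : S × Z => q.1 • q.2))
    (hXG : ∀ g ∈ G, ∀ x ∈ X, g • x ∈ X)
    (hσ : σ ∈ Set.extremePoints ℝ (momentumHull B p μ X))
    (hβ : β ∈ exposingConeFixed Θ G B p (momentumHull B p μ X) σ) :
    stabK Θ G σ = stabK Θ G β := by
  refine Set.Subset.antisymm (fun k hk => ⟨hk.1, hβ.2 k hk⟩) fun k hk => ⟨hk.1, ?_⟩
  obtain ⟨x, hx, hxσ⟩ := extremePoints_convexHull_subset hσ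
  have hfib := fiber_eq_maxSet hB hG hσ hβ.1
  have hxm : x ∈ maxSet B p μ X β := hfib ▸ ⟨hx, hxσ⟩
  have h1 := smul_mem_maxSet hΘ hB hG hμ hact hXG hβ.1.1
    (mem_centralizerIn_iff.2 ⟨hk.1.2, hk.2⟩) hxm
  rw [← hfib] at h1
  have h2 := restrictedMomentum_smul hB hG hμ hk.1 x
  rw [h1.2, hxσ] at h2
  exact h2.symm

/-- The only element of `R^{β-}` fixing a point of `X^β_max` is the identity. -/
theorem eq_one_of_mem_Rminus (hΘ : IsCartanInvolution E Θ)
    (hB : IsInvariantInnerProduct Θ B) (hG : IsCompatible Θ G p) (hμ : IsMomentumMap Θ B h μ)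
    (hact : ContMDiff (𝓘(ℂ, E).prod 𝓘(ℂ, F)) 𝓘(ℂ, F) ω (fun q : S × Z => q.1 • q.2))
    (hXG : ∀ g ∈ G, ∀ x ∈ X, g • x ∈ X)
    (hσ : σ ∈ Set.extremePoints ℝ (momentumHull B p μ X))
    (hβ : β ∈ exposingConeFixed Θ G B p (momentumHull B p μ X) σ) {x : Z}
    (hx : x ∈ maxSet B p μ X β) {g : S} (hg : g ∈ Rminus G β) (hgx : g • x = x) : g = 1 := by
  have := topologicalGroup_of_lieGroup 𝓘(ℂ, E) ω (G := S)
  have hβp := hβ.1.1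
  have hβu := hG.le_iu hβp
  have hΘβ : ∀ t : ℝ, Θ (lieExp S (t • β)) = lieExp S (-(t • β)) := fun t => by
    rw [hΘ.map_lieExp_of_mem ((iu Θ).smul_mem t hβu), lieExp_neg]
  have hΘβ' : ∀ t : ℝ, Θ (lieExp S (-(t • β))) = lieExp S (t • β) := fun t => by
    have := hΘβ (-t)
    simpa using this
  have hΘc : Continuous Θ := hΘ.smooth.continuous
  -- `Θ` inverts `exp(tβ)`, so it exchanges the limits at `+∞` and `-∞`.
  have hΘlim : Filter.Tendsto (fun t : ℝ => lieExp S (t • β) * Θ g * lieExp S (-(t • β)))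
      Filter.atBot (𝓝 1) := by
    have h1 := (hΘc.tendsto 1).comp (hg.2.comp Filter.tendsto_neg_atBot_atTop)
    rw [map_one] at h1
    refine h1.congr fun t => ?_
    simp only [Function.comp_apply, map_mul, hΘβ, hΘβ', neg_smul, neg_neg]
  have hΘx : Θ g • x = x := smul_eq_self_of_mem_Rplus hB hG hμ hact hXG hβp hx
    ⟨hG.map_mem hΘ hg.1, hΘlim⟩
  obtain ⟨k, hk, α, hα, rfl⟩ := (hG.mem_iff g).1 hg.1
  have hαu := hG.le_iu hα
  have hΘg : Θ (k * lieExp S α) = k * (lieExp S α)⁻¹ := by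
    rw [map_mul, hΘ.map_lieExp_of_mem hαu, mem_fixedSubgroup_iff.1 hk.1]
  -- Both `g` and `Θ(g)` fix `x`, hence so does `Θ(g)⁻¹g = exp(2α)`.
  have hexp : lieExp S ((2 : ℝ) • α) • x = x := by
    have h1 : lieExp S ((2 : ℝ) • α) = (Θ (k * lieExp S α))⁻¹ * (k * lieExp S α) := by
      have h2 := lieExp_add_smul (S := S) α 1 1
      rw [one_smul, one_add_one_eq_two] at h2
      rw [h2, hΘg]
      group
    rw [h1, mul_smul, hgx, inv_smul_eq_iff, hΘx]
  have hα0 : fundVec S F α x = 0 := hμ.fundVec_eq_zero hact hαu two_pos (by rw [hexp])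
  have hαx : lieExp S α • x = x := by
    have := lieExp_smul_eq_self hact hα0 1
    rwa [one_smul] at this
  have hkx : k • x = x := by rwa [mul_smul, hαx] at hgx
  -- Equivariance at the fixed point `x` gives `k ∈ K^σ`, and `β` is `K^σ`-fixed.
  have hkβ : Ad k β = β := by
    refine hβ.2 k ⟨hk, ?_⟩
    have h1 := restrictedMomentum_smul hB hG hμ hk x
    rw [← fiber_eq_maxSet hB hG hσ hβ.1] at hx
    rw [hkx, hx.2] at h1
    exact h1.symm
  have hcomm := Ad_eq_self_iff.1 hkβ
  -- Here `g = kΘ(g)⁻¹k` and `k` commutes with `exp(tβ)`, so the limit `1` for the conjugates of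
  -- `Θ(g)` becomes `k²` for those of `g`.
  have hback : Filter.Tendsto
      (fun t : ℝ => lieExp S (t • β) * (k * lieExp S α) * lieExp S (-(t • β)))
      Filter.atBot (𝓝 (k * k)) := by
    rw [hΘg] at hΘlim
    have h1 := ((hΘlim.inv).const_mul k).mul_const k
    rw [inv_one, mul_one] at h1
    refine h1.congr fun t => ?_
    have h2 : lieExp S (t • β) * (k * (lieExp S α)⁻¹) * lieExp S (-(t • β)) =
        k * (lieExp S (t • β) * (lieExp S α)⁻¹ * lieExp S (-(t • β))) := by
      rw [← mul_assoc, ← hcomm t]; group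
    rw [h2, ← mul_assoc (lieExp S (t • β)) k, ← hcomm t, lieExp_neg]
    have h3 : (lieExp S (t • β))⁻¹ * k = k * (lieExp S (t • β))⁻¹ := by
      have := hcomm (-t)
      rw [neg_smul, lieExp_neg] at this
      exact this.symm
    group
  -- With limits at both ends, `Ad g = Ad 1`; so `g` commutes with `exp(tβ)`, its conjugates are all
  -- `g`, and their limit `1` is `g`.
  have hAd := hΘ.Ad_eq_of_tendsto_conj hβu hg.2 hback
  rw [Ad_one] at hAd
  have hfix : Ad (k * lieExp S α) β = β := by rw [hAd]; rfl
  have hgc := Ad_eq_self_iff.1 hfix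
  have hlim := hg.2
  have hconst : ∀ t : ℝ, lieExp S (t • β) * (k * lieExp S α) * lieExp S (-(t • β)) =
      k * lieExp S α := fun t => by
    rw [← hgc t, lieExp_neg]; group
  simp only [hconst] at hlim
  exact tendsto_nhds_unique tendsto_const_nhds hlim

end Main

end GradientMap

end

/-! ### The proposition -/

open GradientMap in
theorem proposition4p2
    {E : Type*} [NormedAddCommGroup E] [NormedSpace ℂ E] [FiniteDimensional ℂ E]
    {S : Type*} [Group S] [TopologicalSpace S] [ChartedSpace E S] [LieGroup 𝓘(ℂ, E) ω S]
    [T2Space S]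
    {F : Type*} [NormedAddCommGroup F] [NormedSpace ℂ F] [FiniteDimensional ℂ F]
    {Z : Type*} [TopologicalSpace Z] [ChartedSpace F Z] [IsManifold 𝓘(ℂ, F) ω Z] [T2Space Z]
    [MulAction S Z]
    -- a holomorphic action of the complex reductive group `S = U^ℂ` on `Z`
    (Θ : S ≃* S) (hΘ : IsCartanInvolution E Θ)
    (hact : ContMDiff (𝓘(ℂ, E).prod 𝓘(ℂ, F)) 𝓘(ℂ, F) ω (fun q : S × Z => q.1 • q.2))
    -- a `U`-invariant Kähler structure with momentum map `μ : Z → i𝔲`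
    (h : RiemMetric F Z) (hKahler : h.IsKahler) (hInv : h.IsInvariant (fixedSubgroup Θ))
    (B : LinearMap.BilinForm ℝ E) (hB : IsInvariantInnerProduct Θ B)
    (μ : Z → E) (hμ : IsMomentumMap Θ B h μ)
    -- a compatible subgroup `G = K exp 𝔭`
    (G : Subgroup S) (p : Submodule ℝ E) (hG : IsCompatible Θ G p)
    -- a compact `G`-invariant subset `X`
    (X : Set Z) (hXc : IsCompact X) (hXG : ∀ g ∈ G, ∀ x ∈ X, g • x ∈ X)
    -- an extreme point of the convex envelope of `μ_𝔭(X)`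
    (σ : E) (hσ : σ ∈ Set.extremePoints ℝ (momentumHull B p μ X)) :
    -- (1)
    (∀ β ∈ exposingCone B p (momentumHull B p μ X) σ,
      {x | x ∈ X ∧ restrictedMomentum B p μ x = σ} = maxSet B p μ X β) ∧
    -- (2)
    (∀ β ∈ p,
      maxSet B p μ X β ⊆ zeroSet S F X β ∧
      IsClopen ((↑) ⁻¹' maxSet B p μ X β : Set (zeroSet S F X β)) ∧
      ∀ g ∈ centralizerIn G β, ∀ x ∈ maxSet B p μ X β, g • x ∈ maxSet B p μ X β) ∧
    -- (3)
    (∀ β ∈ exposingCone B p (momentumHull B p μ X) σ, ∀ x ∈ maxSet B p μ X β,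
      IsCompact (MulAction.orbit (centralizerIn G β) x) ∧
      ∀ α ∈ pCentralizer G p β, fundVec S F α x = 0) ∧
    -- (4)
    (∀ β ∈ exposingCone B p (momentumHull B p μ X) σ, ∀ x ∈ maxSet B p μ X β,
      ∀ ξ : E, ξ ∈ lieAlgebraOf (Rplus G β) → fundVec S F ξ x = 0) ∧
    -- (5)
    (∀ β ∈ exposingConeFixed Θ G B p (momentumHull B p μ X) σ,
      stabK Θ G σ = stabK Θ G β) ∧
    -- (6)
    (∀ β ∈ exposingConeFixed Θ G B p (momentumHull B p μ X) σ, ∀ x ∈ maxSet B p μ X β,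
      ∀ ξ : E, ξ ∈ lieAlgebraOf (Rminus G β) → ξ ≠ 0 → fundVec S F ξ x ≠ 0) := by
  refine ⟨fun β hβ => fiber_eq_maxSet hB hG hσ hβ, fun β hβ =>
    ⟨maxSet_subset_zeroSet hB hG hμ hact hXG hβ, isClopen_maxSet hΘ hB hG hμ hact hβ,
      fun g hg x hx => smul_mem_maxSet hΘ hB hG hμ hact hXG hβ hg hx⟩,
    fun β hβ x hx => ⟨isCompact_orbit_centralizerIn hΘ hB hG hμ hact hXG hσ hβ hx,
      fun α hα => fundVec_eq_zero_of_mem_pCentralizer hΘ hB hG hμ hact hXG hσ hβ hx hα⟩,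
    fun β hβ x hx ξ hξ => fundVec_eq_zero_of_fixed hact fun t =>
      smul_eq_self_of_mem_Rplus hB hG hμ hact hXG hβ.1 hx (hξ t),
    fun β hβ => stabK_eq hΘ hB hG hμ hact hXG hσ hβ, fun β hβ x hx ξ hξ hne h0 => hne ?_⟩
  -- If `ξ_X(x) = 0`, each `exp(tξ)` lies in `R^{β-}` and fixes `x`, hence is `1`, which forces `ξ =
  -- 0`.
  refine eq_of_lieExp_smul_eq (S := S) fun t => ?_
  rw [smul_zero, lieExp_zero]
  exact eq_one_of_mem_Rminus hΘ hB hG hμ hact hXG hσ hβ hx (hξ t) (lieExp_smul_eq_self hact h0 t)
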